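/- Let $\Lambda\subset\mathbb C^2$ be a lattice, $\pi:\mathbb C^2\to\mathbb T^2=\mathbb C^2/\Lambda$ the projection, and for $e\in\mathbb C^2$ let $\tau_e$ be the automorphism of $\mathbb T^2$ induced by the translation $x\mapsto x+e$. Let $(X,\mathcal L)$ be a (not necessarily Lipschitz) compact subset $X\subset\mathbb T^2$ laminated by holomorphically embedded Riemann surfaces. This means that $X$ is covered by pairwise compatible flow boxes of the following kind. A horizontal flow box centered at $p=(p_1,p_2)$ consists of an open set $U\subset\mathbb C^2$ on which $\pi$ is injective, a disk $\Delta_\delta=\{|z|<\delta\}$ with $\delta>0$, a set $T\subset\mathbb C$ with $p_2\in T$, and holomorphic functions $f_w:\Delta_\delta\to\mathbb C$ with $f_w(0)=0$ ($w\in T$), such that $\psi(z,w)=(p_1+z,\,w+f_w(z))$ is a homeomorphism of $\Delta_\delta\times T$ onto $U\cap\pi^{-1}(X)$; vertical flow boxes are defined in the same way with the two coordinates exchanged. Its plaques are the sets $\Gamma_w=\pi(\psi(\Delta_\delta\times\{w\}))$, $w\in T$. Two flow boxes are compatible if every plaque of one meets every plaque of the other in a set that is open in both plaques; a flow box of the lamination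 is one that is compatible with the given ones. Suppose that $(X,\mathcal L)$ has no invariant complex line segments, that is, there are no complex affine line $Y\subset\mathbb C^2$ and open set $U\subset\mathbb C^2$ with $\emptyset\neq Y\cap U\subset\pi^{-1}(X)$. Then there exist $\epsilon_0>0$, $A>0$ and a finite covering $\{B_i\}$ of $X$ by flow boxes of the lamination such that for every $\epsilon\in\mathbb C$ with $0<|\epsilon|<\epsilon_0$, for both translations $\tau=\tau_{(\epsilon,0)}$ and $\tau=\tau_{(0,\epsilon)}$, and for any two (possibly equal) plaques $\Gamma_\alpha,\Gamma_\beta$ of the same flow box $B_i$, $$\#\bigl(\Gamma_\alpha\cap\tau(\Gamma_\beta)\bigr)\le A\log\frac1{|\epsilon|}.$$ -/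

import Mathlib

namespace TorusLam

/-- The two-dimensional torus `ℂ² / Λ`. (That `Λ` is a lattice is assumed where it is used.) -/
abbrev Torus (Λ : Submodule ℤ (ℂ × ℂ)) : Type := (ℂ × ℂ) ⧸ Λ.toAddSubgroup

/-- The projection `π : ℂ² → ℂ² / Λ`. -/
def proj (Λ : Submodule ℤ (ℂ × ℂ)) (x : ℂ × ℂ) : Torus Λ := QuotientAddGroup.mk x

/-- The automorphism of the torus induced by the translation `x ↦ x + e` of `ℂ²`. -/
def translation (Λ : Submodule ℤ (ℂ × ℂ)) (e : ℂ × ℂ) (x : Torus Λ) : Torus Λ := x + proj Λ e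

/-- The two kinds of flow boxes. -/
inductive Direction
  | horizontal
  | vertical

/-- The graph point `(p₁ + z, w + h)` (horizontal), respectively `(w + h, p₂ + z)` (vertical). -/
def Direction.graphPoint (d : Direction) (p : ℂ × ℂ) (w z h : ℂ) : ℂ × ℂ :=
  match d with
  | .horizontal => (p.1 + z, w + h)
  | .vertical => (w + h, p.2 + z)

/-- The transverse coordinate of a point: the second one for horizontal boxes, the first one for
vertical boxes. -/
def Direction.transverse (d : Direction) (p : ℂ × ℂ) : ℂ :=
  match d with
  | .horizontal => p.2
  | .vertical => p.1

/-- A (horizontal or vertical) flow box for the subset `X` of the torus, centered at `center`: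
an open set `domain` of `ℂ²` on which `π` is injective, together with a homeomorphism
`ψ : Δ_δ × T → domain ∩ π⁻¹(X)`, `ψ (z, w) = (p₁ + z, w + f_w(z))` (with the roles of the
coordinates exchanged for a vertical box), where each `f_w` is holomorphic on the disk `Δ_δ` of
radius `δ` and vanishes at `0`. -/
structure FlowBox (Λ : Submodule ℤ (ℂ × ℂ)) (X : Set (Torus Λ)) where
  dir : Direction
  center : ℂ × ℂ
  domain : Set (ℂ × ℂ)
  isOpen_domain : IsOpen domain
  injOn_proj : Set.InjOn (proj Λ) domain
  radius : ℝ
  radius_pos : 0 < radius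
  /-- the transversal `T` -/
  transversal : Set ℂ
  center_mem : dir.transverse center ∈ transversal
  /-- the functions `f_w`; only `w ∈ T` and `z ∈ Δ_δ` matter -/
  f : ℂ → ℂ → ℂ
  holomorphic : ∀ w ∈ transversal, DifferentiableOn ℂ (f w) (Metric.ball 0 radius)
  f_zero : ∀ w ∈ transversal, f w 0 = 0
  isEmbedding : Topology.IsEmbedding
    (fun q : Metric.ball (0 : ℂ) radius × transversal =>
      dir.graphPoint center (q.2 : ℂ) (q.1 : ℂ) (f q.2 q.1))
  range_eq : Set.range
    (fun q : Metric.ball (0 : ℂ) radius × transversal =>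
      dir.graphPoint center (q.2 : ℂ) (q.1 : ℂ) (f q.2 q.1)) = domain ∩ proj Λ ⁻¹' X

namespace FlowBox

variable {Λ : Submodule ℤ (ℂ × ℂ)} {X : Set (Torus Λ)}

/-- The point `ψ (z, w)` of `ℂ²`. -/
def param (B : FlowBox Λ X) (w z : ℂ) : ℂ × ℂ := B.dir.graphPoint B.center w z (B.f w z)

/-- The plaque `Γ_w`, as a subset of the torus. -/
def plaque (B : FlowBox Λ X) (w : ℂ) : Set (Torus Λ) :=
  (fun z => proj Λ (B.param w z)) '' Metric.ball 0 B.radius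

/-- The open subset of the torus underlying the flow box. -/
def image (B : FlowBox Λ X) : Set (Torus Λ) := proj Λ '' B.domain

/-- Each plaque of `B` meets each plaque of `C` in a relatively open subset of the former
(expressed in the coordinate `z ∈ Δ_δ` of the plaque of `B`). -/
def OverlapsOpenly (B C : FlowBox Λ X) : Prop :=
  ∀ w ∈ B.transversal, ∀ w' ∈ C.transversal,
    IsOpen {z : ℂ | z ∈ Metric.ball (0 : ℂ) B.radius ∧ proj Λ (B.param w z) ∈ C.plaque w'}

/-- Two flow boxes are compatible if on the overlap their plaques fit together: the intersection
of a plaque of one with a plaque of the other is open in both. -/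
def Compatible (B C : FlowBox Λ X) : Prop := B.OverlapsOpenly C ∧ C.OverlapsOpenly B

end FlowBox

/-- A compact subset of the torus `ℂ² / Λ` laminated by (holomorphically embedded) Riemann
surfaces: a compact set with an atlas of pairwise compatible flow boxes covering it. -/
structure Lamination (Λ : Submodule ℤ (ℂ × ℂ)) where
  carrier : Set (Torus Λ)
  isCompact_carrier : IsCompact carrier
  atlas : Set (FlowBox Λ carrier)
  covers : ∀ x ∈ carrier, ∃ B ∈ atlas, x ∈ B.image
  compatible : ∀ B ∈ atlas, ∀ C ∈ atlas, B.Compatible C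

namespace Lamination

variable {Λ : Submodule ℤ (ℂ × ℂ)}

/-- A flow box of the lamination: one whose plaques fit together with those of the atlas. -/
def IsFlowBox (L : Lamination Λ) (B : FlowBox Λ L.carrier) : Prop :=
  ∀ C ∈ L.atlas, B.Compatible C

/-- The lamination has invariant complex line segments: for some complex affine line `Y` and some
open set `U` of `ℂ²` with `Y ∩ U` nonempty, `Y ∩ U` lies in `π⁻¹(X)`. -/
def HasInvariantLineSegments (L : Lamination Λ) : Prop :=
  ∃ (Y : AffineSubspace ℂ (ℂ × ℂ)) (U : Set (ℂ × ℂ)),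
    Module.finrank ℂ Y.direction = 1 ∧ IsOpen U ∧ ((Y : Set (ℂ × ℂ)) ∩ U).Nonempty ∧
      (Y : Set (ℂ × ℂ)) ∩ U ⊆ proj Λ ⁻¹' L.carrier

end Lamination

end TorusLam

/-! In a flow box the plaques are graphs of holomorphic functions, and an intersection of the plaque
`a` with the translate of the plaque `b` by `ε • v` is a zero of the holomorphic function `gap`.
Each zero in a small disk costs a bounded holomorphic function a fixed factor of its size there
(`norm_le_of_zeros`). So if the supremum of the gap on such a disk is at least a fixed power `‖ε‖ ^
M`, there are only O(log(1/|ε|)) zeros. The estimate can fail near a plaque only if that plaque is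
`NearlyInvariant`: arbitrarily close to it there are pairs of plaques whose gap is smaller than any
prescribed power of a small `ε`.

It remains to exclude this. By a two-constants estimate (`exists_exponent_two_constants`), smallness
beyond all powers on a small disk spreads over the whole plaque, with a loss only in the exponent.
Hence near invariance is a property of the plaque and does not depend on the flow box
(`NearlyInvariant.change_box`); the nearly invariant points form a compact set K, a union of
plaques. A Hurwitz argument shows that a nearly invariant plaque is never tangent to `v`: at an
isolated tangency two distinct nearby plaques would meet (`det2_tangent_ne_zero`). The slope
relative to `v` is therefore finite on K, continuous there, and holomorphic along plaques. If K were
nonempty, the modulus of the slope would have a maximum on K, and the maximum principle would make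
the slope constant near that point of its plaque, which would contain a line segment. So K is empty
(`nearlyInvariantSet_eq_empty`), the count holds near each point, and compactness of the carrier
makes the constants uniform. -/

open Metric Set Filter Topology

/-! ### Quantitative function theory on disks. -/

namespace TorusLam

/-- Qualitative form of the Hadamard three circles theorem. -/
theorem exists_exponent_three_circles (c : ℂ) {r r' R : ℝ} (hr : 0 < r) (hr' : 0 < r')
    (hR : r' < R) :
    ∃ θ : ℝ, 0 < θ ∧ θ ≤ 1 ∧ ∀ g : ℂ → ℂ, DifferentiableOn ℂ g (ball c R) →
      (∀ z ∈ ball c R, ‖g z‖ ≤ 1) → ∀ m : ℝ, 0 < m → m ≤ 1 → (∀ z ∈ ball c r, ‖g z‖ ≤ m) →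
      ∀ z ∈ ball c r', ‖g z‖ ≤ m ^ θ := by
  set a : ℝ := min r r' / 2 with ha
  set b : ℝ := (r' + R) / 2 with hb
  have ha0 : 0 < a := by positivity
  have har : a < r := by have := min_le_left r r'; linarith
  have har' : a < r' := by have := min_le_right r r'; linarith
  have hrb : r' < b := by rw [hb]; linarith
  have hbR : b < R := by rw [hb]; linarith
  have h1 : Real.log a < Real.log r' := Real.log_lt_log ha0 har'
  have h2 : Real.log r' < Real.log b := Real.log_lt_log hr' hrb
  have h3 : 0 < Real.log b - Real.log a := by linarith
  have hθ1 : (1 - (Real.log r' - Real.log a) / (Real.log b - Real.log a)) ≤ 1 := by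
    have : 0 ≤ (Real.log r' - Real.log a) / (Real.log b - Real.log a) :=
      div_nonneg (by linarith) h3.le
    linarith
  refine ⟨1 - (Real.log r' - Real.log a) / (Real.log b - Real.log a), ?_, hθ1, ?_⟩
  · rw [sub_pos, div_lt_one h3]; linarith
  intro g hg hg1 m hm0 hm1 hgm z hz
  rw [mem_ball, dist_eq_norm] at hz
  by_cases hza : ‖z - c‖ ≤ a
  · refine (hgm z ?_).trans ?_
    · rw [mem_ball, dist_eq_norm]; linarith
    · exact Real.self_le_rpow_of_le_one hm0.le hm1 hθ1
  push Not at hza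
  have hz0 : 0 < ‖z - c‖ := ha0.trans hza
  have hne : z - c ≠ 0 := norm_pos_iff.1 hz0
  have hnorm : ∀ w : ℂ, ‖(c + Complex.exp w) - c‖ = Real.exp w.re := fun w => by
    rw [add_sub_cancel_left, Complex.norm_exp]
  have hmem : ∀ w : ℂ, w.re ≤ Real.log b → c + Complex.exp w ∈ ball c R := fun w hw => by
    rw [mem_ball, dist_eq_norm, hnorm]
    exact (Real.exp_le_exp.2 hw).trans_lt (by rw [Real.exp_log (by linarith)]; exact hbR)
  -- The map w ↦ c + exp w turns the annulus between the radii `a` and `b` into a vertical strip,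
  -- where the three lines theorem applies. Since `a < r`, the bound `m` holds on the left edge; `θ`
  -- is the exponent obtained at radius `r'`.
  have key := Complex.HadamardThreeLines.norm_le_interp_of_mem_verticalClosedStrip'
    (f := fun w => g (c + Complex.exp w)) (z := Complex.log (z - c)) (a := m) (b := 1)
    (l := Real.log a) (u := Real.log b) (by linarith) ?_ ?_ ?_ ?_ ?_
  · simp only [Complex.exp_log hne, add_sub_cancel, Real.one_rpow, mul_one, Complex.log_re] at key
    refine key.trans (Real.rpow_le_rpow_of_exponent_ge hm0 hm1 ?_)
    have : Real.log ‖z - c‖ ≤ Real.log r' := Real.log_le_log hz0 hz.le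
    gcongr
  · simp only [Complex.HadamardThreeLines.verticalClosedStrip, mem_preimage, mem_Icc,
      Complex.log_re]
    exact ⟨Real.log_le_log ha0 hza.le, Real.log_le_log hz0 (by linarith)⟩
  · apply DifferentiableOn.diffContOnCl
    refine DifferentiableOn.comp (t := ball c R) hg (by fun_prop) ?_
    intro w hw
    have hw' : w.re ≤ Real.log b := by
      have hcl : closure (Complex.HadamardThreeLines.verticalStrip (Real.log a) (Real.log b)) ⊆
          {w : ℂ | w.re ≤ Real.log b} :=
        closure_minimal (fun w hw => hw.2.le) (isClosed_le Complex.continuous_re continuous_const)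
      exact hcl hw
    exact hmem w hw'
  · refine ⟨1, ?_⟩
    rintro _ ⟨w, hw, rfl⟩
    exact hg1 _ (hmem w hw.2)
  · intro w hw
    simp only [mem_preimage, mem_singleton_iff] at hw
    refine hgm _ ?_
    rw [mem_ball, dist_eq_norm, hnorm, hw, Real.exp_log ha0]
    exact har
  · intro w hw
    simp only [mem_preimage, mem_singleton_iff] at hw
    exact hg1 _ (hmem w hw.le)

/-- A bounded holomorphic function on a disk which is small on a small disk is small, with a
uniform exponent, on every compact subdisk. -/
theorem exists_exponent_two_constants {z₁ : ℂ} {r ρ R : ℝ} (hz₁ : z₁ ∈ ball (0 : ℂ) R)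
    (hr : 0 < r) (hρ : ρ < R) :
    ∃ θ : ℝ, 0 < θ ∧ θ ≤ 1 ∧ ∀ g : ℂ → ℂ, DifferentiableOn ℂ g (ball 0 R) →
      (∀ z ∈ ball (0 : ℂ) R, ‖g z‖ ≤ 1) → ∀ m : ℝ, 0 < m → m ≤ 1 →
      (∀ z ∈ ball z₁ r ∩ ball 0 R, ‖g z‖ ≤ m) → ∀ z ∈ closedBall (0 : ℂ) ρ, ‖g z‖ ≤ m ^ θ := by
  set Q : Set ℂ → Prop := fun S => ∃ θ : ℝ, 0 < θ ∧ θ ≤ 1 ∧ ∀ g : ℂ → ℂ,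
      DifferentiableOn ℂ g (ball 0 R) →
      (∀ z ∈ ball (0 : ℂ) R, ‖g z‖ ≤ 1) → ∀ m : ℝ, 0 < m → m ≤ 1 →
      (∀ z ∈ ball z₁ r ∩ ball 0 R, ‖g z‖ ≤ m) → ∀ z ∈ S, ‖g z‖ ≤ m ^ θ with hQ
  have hmono : ∀ {S S' : Set ℂ}, S ⊆ S' → Q S' → Q S := by
    rintro S S' hS ⟨θ, h0, h1, h⟩
    exact ⟨θ, h0, h1, fun g hg hg1 m hm hm1 hgm z hz => h g hg hg1 m hm hm1 hgm z (hS hz)⟩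
  have hunion : ∀ {S S' : Set ℂ}, Q S → Q S' → Q (S ∪ S') := by
    rintro S S' ⟨θ, h0, h1, h⟩ ⟨θ', h0', h1', h'⟩
    refine ⟨min θ θ', lt_min h0 h0', (min_le_left _ _).trans h1, ?_⟩
    rintro g hg hg1 m hm hm1 hgm z (hz | hz)
    · exact (h g hg hg1 m hm hm1 hgm z hz).trans
        (Real.rpow_le_rpow_of_exponent_ge hm hm1 (min_le_left _ _))
    · exact (h' g hg hg1 m hm hm1 hgm z hz).trans
        (Real.rpow_le_rpow_of_exponent_ge hm hm1 (min_le_right _ _))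
  -- Continuation along the disk: `A` is open, contains `z₁` and, by the three circles estimate, is
  -- relatively closed, so it is the whole disk. Compactness then leaves finitely many exponents,
  -- and their minimum works.
  set A : Set ℂ := {z | ∃ s > 0, Q (ball z s)} with hA
  have hAopen : IsOpen A := by
    rw [Metric.isOpen_iff]
    rintro z ⟨s, hs, hQs⟩
    refine ⟨s, hs, fun z' hz' => ⟨s - dist z' z, by rw [mem_ball] at hz'; linarith, ?_⟩⟩
    exact hmono (ball_subset_ball' (by linarith)) hQs
  have hz₁A : z₁ ∈ A := by
    rw [mem_ball_zero_iff] at hz₁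
    refine ⟨min r (R - ‖z₁‖), lt_min hr (by linarith), 1, one_pos, le_rfl, ?_⟩
    intro g hg hg1 m hm hm1 hgm z hz
    rw [Real.rpow_one]
    refine hgm z ⟨ball_subset_ball (min_le_left _ _) hz, ?_⟩
    refine ball_subset_ball' (ε₁ := min r (R - ‖z₁‖)) ?_ hz
    rw [dist_zero_right]
    have := min_le_right r (R - ‖z₁‖)
    linarith
  have hsub : ball (0 : ℂ) R ⊆ A := by
    refine (convex_ball (0 : ℂ) R).isPreconnected.subset_of_closure_inter_subset hAopen
      ⟨z₁, hz₁, hz₁A⟩ ?_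
    rintro z ⟨hzc, hzR⟩
    rw [mem_ball_zero_iff] at hzR
    set d : ℝ := R - ‖z‖ with hd
    have hd0 : 0 < d := by rw [hd]; linarith
    -- A point `z₀` of `A` at distance less than `d / 4` from `z` has its disk of radius `d / 2`
    -- inside the domain, while its disk of radius `3 * d / 8` contains a disk about `z`. The two
    -- exponents multiply.
    obtain ⟨z₀, ⟨s, hs, θ, hθ0, hθ1, hθ⟩, hz₀⟩ := Metric.mem_closure_iff.1 hzc (d / 4) (by linarith)
    obtain ⟨θ', hθ0', hθ1', h3⟩ := exists_exponent_three_circles z₀ (r := s) (r' := 3 * d / 8)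
      (R := d / 2) hs (by linarith) (by linarith)
    have hsubR : ball z₀ (d / 2) ⊆ ball 0 R := by
      apply ball_subset_ball'
      have := dist_triangle z₀ z 0
      rw [dist_zero_right z, dist_comm z₀ z] at this
      linarith
    refine ⟨d / 8, by linarith, θ * θ', mul_pos hθ0 hθ0', ?_, ?_⟩
    · nlinarith
    intro g hg hg1 m hm hm1 hgm w hw
    rw [Real.rpow_mul hm.le]
    refine h3 g (hg.mono hsubR) (fun z hz => hg1 z (hsubR hz)) (m ^ θ) (Real.rpow_pos_of_pos hm _)
      (Real.rpow_le_one hm.le hm1 hθ0.le) (hθ g hg hg1 m hm hm1 hgm) w ?_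
    exact ball_subset_ball' (by linarith) hw
  refine (isCompact_closedBall (0 : ℂ) ρ).induction_on (p := Q) ?_ (fun _ _ h h' => hmono h h')
    (fun _ _ h h' => hunion h h') ?_
  · exact ⟨1, one_pos, le_rfl, fun _ _ _ _ _ _ _ z hz => absurd hz (notMem_empty z)⟩
  · intro z hz
    obtain ⟨s, hs, hQs⟩ := hsub (closedBall_subset_ball hρ hz)
    exact ⟨ball z s, mem_nhdsWithin_of_mem_nhds (ball_mem_nhds z hs), hQs⟩

/-- A bounded holomorphic function with many zeros in a small disk is small there. -/
theorem norm_le_of_zeros {z₀ : ℂ} {r : ℝ} (hr : 0 < r) (S : Finset ℂ) :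
    ∀ (g : ℂ → ℂ) (M : ℝ), DifferentiableOn ℂ g (ball z₀ (8 * r)) →
      (∀ z ∈ ball z₀ (8 * r), ‖g z‖ ≤ M) → (∀ s ∈ S, s ∈ ball z₀ r ∧ g s = 0) →
      ∀ z ∈ ball z₀ r, ‖g z‖ ≤ M * (1 / 2) ^ S.card := by
  induction S using Finset.induction_on with
  | empty =>
    intro g M _ hM _ z hz
    simpa using hM z (ball_subset_ball (by linarith) hz)
  | insert a S haS ih =>
    intro g M hg hM hS z hz
    obtain ⟨ha, hga⟩ := hS a (Finset.mem_insert_self a S)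
    have hM0 : 0 ≤ M := (norm_nonneg _).trans (hM z (ball_subset_ball (by linarith) hz))
    have ha8 : a ∈ ball z₀ (8 * r) := ball_subset_ball (by linarith) ha
    have hfac : ∀ w, g w = (w - a) * dslope g a w := fun w => by
      have := sub_smul_dslope g a w
      rw [hga, sub_zero, smul_eq_mul] at this
      exact this.symm
    have hq : DifferentiableOn ℂ (dslope g a) (ball z₀ (8 * r)) :=
      (Complex.differentiableOn_dslope (isOpen_ball.mem_nhds ha8)).2 hg
    rw [mem_ball] at ha
    -- On circles of radius above `7 * r` the divisor `y - a` has modulus at least `6 * r`, and the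
    -- maximum principle carries the bound inward. On the small disk the divisor is at most `2 * r`,
    -- so each zero gains a factor 1/3.
    have hqM : ∀ w ∈ ball z₀ (8 * r), ‖dslope g a w‖ ≤ M / (6 * r) := by
      intro w hw
      rw [mem_ball] at hw
      obtain ⟨t, ht1, ht2⟩ := exists_between (max_lt hw (show 7 * r < 8 * r by linarith))
      have ht7 := (le_max_right _ _).trans_lt ht1
      have htw := (le_max_left _ _).trans_lt ht1
      refine Complex.norm_le_of_forall_mem_frontier_norm_le (U := ball z₀ t) isBounded_ball
        ?_ ?_ (subset_closure htw)
      · refine (hq.mono ?_).diffContOnCl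
        exact closure_ball_subset_closedBall.trans (closedBall_subset_ball ht2)
      · intro y hy
        rw [frontier_ball z₀ (by linarith : t ≠ 0), mem_sphere] at hy
        have hya : 6 * r ≤ ‖y - a‖ := by
          have := dist_triangle y a z₀
          rw [dist_eq_norm y a] at this
          linarith
        have h1 := hM y (by rw [mem_ball]; linarith)
        rw [hfac y, norm_mul] at h1
        rw [le_div_iff₀ (by linarith)]
        have := mul_le_mul_of_nonneg_right hya (norm_nonneg (dslope g a y))
        linarith
    have hS' : ∀ s ∈ S, s ∈ ball z₀ r ∧ dslope g a s = 0 := by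
      intro s hs
      obtain ⟨h1, h2⟩ := hS s (Finset.mem_insert_of_mem hs)
      refine ⟨h1, ?_⟩
      rw [hfac s] at h2
      refine (mul_eq_zero.1 h2).resolve_left (sub_ne_zero.2 ?_)
      rintro rfl
      exact haS hs
    have h := ih (dslope g a) (M / (6 * r)) hq hqM hS' z hz
    rw [Finset.card_insert_of_notMem haS, hfac z, norm_mul, pow_succ]
    have hza : ‖z - a‖ ≤ 2 * r := by
      have := dist_triangle_right z a z₀
      rw [dist_eq_norm z a] at this
      rw [mem_ball] at hz
      linarith
    calc ‖z - a‖ * ‖dslope g a z‖ ≤ (2 * r) * (M / (6 * r) * (1 / 2) ^ S.card) := by gcongr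
      _ = M * (1 / 2) ^ S.card * (1 / 3) := by field_simp; ring
      _ ≤ M * (1 / 2) ^ S.card * (1 / 2) := by gcongr; norm_num
      _ = M * ((1 / 2) ^ S.card * (1 / 2)) := by ring

/-- A Hurwitz type argument: a function with an isolated zero is not close to a
nonvanishing holomorphic function. -/
theorem exists_eq_zero_of_close {φ h : ℂ → ℂ} {z₀ : ℂ} {s c : ℝ} (hs : 0 < s)
    (hφ : φ z₀ = 0) (hc : ∀ z ∈ sphere z₀ s, c ≤ ‖φ z‖) (hh : DifferentiableOn ℂ h (closedBall z₀ s))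
    (hclose : ∀ z ∈ closedBall z₀ s, ‖h z - φ z‖ < c / 2) : ∃ z ∈ closedBall z₀ s, h z = 0 := by
  by_contra hne
  push Not at hne
  have hz₀ : z₀ ∈ closedBall z₀ s := mem_closedBall_self hs.le
  have h0 : ‖h z₀‖ < c / 2 := by simpa [hφ] using hclose z₀ hz₀
  have hc0 : 0 < c / 2 := (norm_nonneg _).trans_lt h0
  -- If `h` had no zero, the maximum principle for its inverse would transport the lower bound `c /
  -- 2` from the circle to the center, where `h` is smaller than that.
  have key := Complex.norm_le_of_forall_mem_frontier_norm_le (f := fun z => (h z)⁻¹)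
    (U := ball z₀ s) (C := (c / 2)⁻¹) (z := z₀) isBounded_ball ?_ ?_
    (subset_closure (mem_ball_self hs))
  · rw [norm_inv] at key
    have := (inv_le_inv₀ (norm_pos_iff.2 (hne z₀ hz₀)) hc0).1 key
    linarith
  · refine DifferentiableOn.diffContOnCl ?_
    rw [closure_ball z₀ hs.ne']
    exact hh.inv hne
  · intro z hz
    rw [frontier_ball z₀ hs.ne'] at hz
    rw [norm_inv]
    have h1 := hclose z (sphere_subset_closedBall hz)
    have h2 := hc z hz
    have h3 : ‖φ z‖ ≤ ‖h z‖ + ‖h z - φ z‖ := by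
      rw [norm_sub_rev]
      have := norm_add_le (h z) (φ z - h z)
      rwa [add_sub_cancel] at this
    exact inv_anti₀ hc0 (by linarith)

end TorusLam

/-! ### Coordinates of a flow box and uniform estimates for nearby plaques. -/

namespace TorusLam

namespace Direction

/-- The coordinate along the plaques: the first one for horizontal boxes, the second one for
vertical boxes. -/
def tangential (d : Direction) (p : ℂ × ℂ) : ℂ :=
  match d with
  | .horizontal => p.1
  | .vertical => p.2

variable (d : Direction)

@[simp] theorem tangential_graphPoint (p : ℂ × ℂ) (w z h : ℂ) :
    d.tangential (d.graphPoint p w z h) = d.tangential p + z := by cases d <;> rfl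

@[simp] theorem transverse_graphPoint (p : ℂ × ℂ) (w z h : ℂ) :
    d.transverse (d.graphPoint p w z h) = w + h := by cases d <;> rfl

@[simp] theorem tangential_add (p q : ℂ × ℂ) :
    d.tangential (p + q) = d.tangential p + d.tangential q := by cases d <;> rfl

@[simp] theorem transverse_add (p q : ℂ × ℂ) :
    d.transverse (p + q) = d.transverse p + d.transverse q := by cases d <;> rfl

@[simp] theorem tangential_sub (p q : ℂ × ℂ) :
    d.tangential (p - q) = d.tangential p - d.tangential q := by cases d <;> rfl

@[simp] theorem transverse_sub (p q : ℂ × ℂ) :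
    d.transverse (p - q) = d.transverse p - d.transverse q := by cases d <;> rfl

@[simp] theorem tangential_smul (c : ℂ) (p : ℂ × ℂ) :
    d.tangential (c • p) = c * d.tangential p := by cases d <;> rfl

@[simp] theorem transverse_smul (c : ℂ) (p : ℂ × ℂ) :
    d.transverse (c • p) = c * d.transverse p := by cases d <;> rfl

variable {d}

theorem ext_coord {p q : ℂ × ℂ} (h₁ : d.tangential p = d.tangential q)
    (h₂ : d.transverse p = d.transverse q) : p = q := by
  cases d
  · exact Prod.ext h₁ h₂
  · exact Prod.ext h₂ h₁

theorem norm_eq_max (p : ℂ × ℂ) : ‖p‖ = max ‖d.tangential p‖ ‖d.transverse p‖ := by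
  cases d
  · rfl
  · exact (max_comm _ _)

theorem norm_tangential_le (p : ℂ × ℂ) : ‖d.tangential p‖ ≤ ‖p‖ := by
  rw [norm_eq_max (d := d)]; exact le_max_left _ _

theorem norm_transverse_le (p : ℂ × ℂ) : ‖d.transverse p‖ ≤ ‖p‖ := by
  rw [norm_eq_max (d := d)]; exact le_max_right _ _

@[fun_prop] theorem continuous_tangential : Continuous d.tangential := by
  cases d
  · exact continuous_fst
  · exact continuous_snd

@[fun_prop] theorem continuous_transverse : Continuous d.transverse := by
  cases d
  · exact continuous_snd
  · exact continuous_fst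

end Direction

variable {Λ : Submodule ℤ (ℂ × ℂ)} {X : Set (Torus Λ)}

theorem continuous_proj : Continuous (proj Λ) := continuous_quotient_mk'

theorem isOpenMap_proj : IsOpenMap (proj Λ) := QuotientAddGroup.isOpenMap_coe

theorem proj_add (x y : ℂ × ℂ) : proj Λ (x + y) = proj Λ x + proj Λ y := rfl

theorem proj_eq_zero {x : ℂ × ℂ} (hx : x ∈ Λ) : proj Λ x = 0 :=
  (QuotientAddGroup.eq_zero_iff x).2 hx

theorem proj_eq_iff {x y : ℂ × ℂ} : proj Λ x = proj Λ y ↔ ∃ l ∈ Λ, x = y + l := by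
  constructor
  · intro h
    refine ⟨x - y, ?_, by abel⟩
    have h' := QuotientAddGroup.eq.1 h.symm
    rwa [neg_add_eq_sub] at h'
  · rintro ⟨l, hl, rfl⟩
    rw [proj_add, proj_eq_zero hl, add_zero]

namespace FlowBox

variable (B : FlowBox Λ X)

/-- The transverse coordinate of `ψ (z, w)`. -/
def height (w z : ℂ) : ℂ := w + B.f w z

@[simp] theorem tangential_param (w z : ℂ) :
    B.dir.tangential (B.param w z) = B.dir.tangential B.center + z := by simp [param]

@[simp] theorem transverse_param (w z : ℂ) : B.dir.transverse (B.param w z) = B.height w z := by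
  simp [param, height]

variable {B} {w w' z z' : ℂ}

theorem param_mem (hw : w ∈ B.transversal) (hz : z ∈ ball (0 : ℂ) B.radius) :
    B.param w z ∈ B.domain ∩ proj Λ ⁻¹' X := by
  rw [← B.range_eq]
  exact ⟨(⟨z, hz⟩, ⟨w, hw⟩), rfl⟩

theorem param_injective (hw : w ∈ B.transversal) (hz : z ∈ ball (0 : ℂ) B.radius)
    (hw' : w' ∈ B.transversal) (hz' : z' ∈ ball (0 : ℂ) B.radius)
    (h : B.param w z = B.param w' z') : w = w' ∧ z = z' := by
  have := @B.isEmbedding.injective (⟨z, hz⟩, ⟨w, hw⟩) (⟨z', hz'⟩, ⟨w', hw'⟩) h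
  simp only [Prod.mk.injEq, Subtype.mk.injEq] at this
  exact ⟨this.2, this.1⟩

theorem exists_param {y : ℂ × ℂ} (hy : y ∈ B.domain) (hyX : proj Λ y ∈ X) :
    ∃ w ∈ B.transversal, ∃ z ∈ ball (0 : ℂ) B.radius, B.param w z = y := by
  have : y ∈ B.domain ∩ proj Λ ⁻¹' X := ⟨hy, hyX⟩
  rw [← B.range_eq] at this
  obtain ⟨⟨⟨z, hz⟩, ⟨w, hw⟩⟩, h⟩ := this
  exact ⟨w, hw, z, hz, h⟩

variable (B) in
theorem continuousOn_param :
    ContinuousOn (fun q : ℂ × ℂ => B.param q.1 q.2) (B.transversal ×ˢ ball 0 B.radius) := by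
  rw [continuousOn_iff_continuous_domRestrict]
  have h : Continuous (fun q : (B.transversal ×ˢ ball (0 : ℂ) B.radius : Set (ℂ × ℂ)) =>
      ((⟨q.1.2, q.2.2⟩, ⟨q.1.1, q.2.1⟩) : ball (0 : ℂ) B.radius × B.transversal)) := by
    fun_prop
  exact B.isEmbedding.continuous.comp h

variable (B) in
theorem continuousOn_height :
    ContinuousOn (fun q : ℂ × ℂ => B.height q.1 q.2) (B.transversal ×ˢ ball 0 B.radius) := by
  have := (Direction.continuous_transverse (d := B.dir)).comp_continuousOn B.continuousOn_param
  refine this.congr fun q _ => ?_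
  simp

theorem differentiableOn_height (hw : w ∈ B.transversal) :
    DifferentiableOn ℂ (B.height w) (ball 0 B.radius) :=
  (differentiableOn_const w).add (B.holomorphic w hw)

/-- Near a point of the box, `ψ` is close to its value there. -/
theorem exists_param_close (hw : w ∈ B.transversal) (hz : z ∈ ball (0 : ℂ) B.radius)
    {V : Set (ℂ × ℂ)} (hV : V ∈ 𝓝 (B.param w z)) :
    ∃ η > 0, ∀ w' ∈ B.transversal, ‖w' - w‖ < η → ∀ z', ‖z' - z‖ < η →
      z' ∈ ball (0 : ℂ) B.radius ∧ B.param w' z' ∈ V := by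
  have h := B.continuousOn_param (w, z) ⟨hw, hz⟩ hV
  rw [mem_map, mem_nhdsWithin_iff] at h
  obtain ⟨η, hη, h⟩ := h
  obtain ⟨η', hη', h'⟩ := Metric.mem_nhds_iff.1 (isOpen_ball.mem_nhds hz)
  refine ⟨min η η', lt_min hη hη', fun w' hw' hww z' hzz => ?_⟩
  have hz' : z' ∈ ball (0 : ℂ) B.radius :=
    h' (by rw [mem_ball, dist_eq_norm]; exact hzz.trans_le (min_le_right _ _))
  refine ⟨hz', h (a := (w', z')) ⟨?_, hw', hz'⟩⟩
  rw [mem_ball, Prod.dist_eq, dist_eq_norm, dist_eq_norm]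
  exact (max_lt hww hzz).trans_le (min_le_left _ _)

/-- The points of `π⁻¹(X)` near `ψ (z, w)` have coordinates close to `(z, w)`. -/
theorem exists_param_near (hw : w ∈ B.transversal) (hz : z ∈ ball (0 : ℂ) B.radius) {η : ℝ}
    (hη : 0 < η) : ∃ r > 0, ∀ y : ℂ × ℂ, ‖y - B.param w z‖ < r → proj Λ y ∈ X →
      ∃ w' ∈ B.transversal, ‖w' - w‖ < η ∧ ∃ z' ∈ ball (0 : ℂ) B.radius, ‖z' - z‖ < η ∧
        B.param w' z' = y := by
  set q₀ : ball (0 : ℂ) B.radius × B.transversal := (⟨z, hz⟩, ⟨w, hw⟩) with hq₀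
  have h1 : ball q₀ η ∈ 𝓝 q₀ := ball_mem_nhds _ hη
  rw [B.isEmbedding.nhds_eq_comap, mem_comap] at h1
  obtain ⟨V, hV, hVη⟩ := h1
  have h2 : V ∩ B.domain ∈ 𝓝 (B.param w z) :=
    inter_mem hV (B.isOpen_domain.mem_nhds (param_mem hw hz).1)
  obtain ⟨r, hr, hrV⟩ := Metric.mem_nhds_iff.1 h2
  refine ⟨r, hr, fun y hy hyX => ?_⟩
  have hyV := hrV (show y ∈ ball _ r by rwa [mem_ball, dist_eq_norm])
  obtain ⟨w', hw', z', hz', rfl⟩ := exists_param hyV.2 hyX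
  have h3 := hVη (show (⟨⟨z', hz'⟩, ⟨w', hw'⟩⟩ : ball (0 : ℂ) B.radius × B.transversal) ∈ _
    from hyV.1)
  rw [mem_ball, Prod.dist_eq, max_lt_iff] at h3
  refine ⟨w', hw', ?_, z', hz', ?_, rfl⟩
  · have := h3.2; rwa [Subtype.dist_eq, dist_eq_norm] at this
  · have := h3.1; rwa [Subtype.dist_eq, dist_eq_norm] at this

/-- Nearby plaques are uniformly close on compact subdisks. -/
theorem exists_height_close (hw : w ∈ B.transversal) {ρ c : ℝ} (hρ : ρ < B.radius) (hc : 0 < c) :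
    ∃ η > 0, ∀ w' ∈ B.transversal, ‖w' - w‖ < η → ∀ z ∈ closedBall (0 : ℂ) ρ,
      ‖B.height w' z - B.height w z‖ < c := by
  have h := IsCompact.mem_uniformity_of_prod (f := B.height) (s := B.transversal)
    (isCompact_closedBall (0 : ℂ) ρ)
    (B.continuousOn_height.mono (prod_mono_right (closedBall_subset_ball hρ))) hw
    (dist_mem_uniformity hc)
  obtain ⟨v, hv, h⟩ := h
  obtain ⟨η, hη, hηv⟩ := mem_nhdsWithin_iff.1 hv
  refine ⟨η, hη, fun w' hw' hww z hz => ?_⟩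
  have := h w' (hηv ⟨by rwa [mem_ball, dist_eq_norm], hw'⟩) z hz
  simpa [dist_eq_norm] using this

/-- The slopes of nearby plaques are uniformly close on compact subdisks. -/
theorem exists_deriv_height_close (hw : w ∈ B.transversal) {ρ c : ℝ} (hρ : ρ < B.radius)
    (hc : 0 < c) : ∃ η > 0, ∀ w' ∈ B.transversal, ‖w' - w‖ < η → ∀ z ∈ closedBall (0 : ℂ) ρ,
      ‖deriv (B.height w') z - deriv (B.height w) z‖ ≤ c := by
  set s : ℝ := (B.radius - ρ) / 2 with hs
  have hs0 : 0 < s := by rw [hs]; linarith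
  -- Closeness `c * s` on a disk larger by `s` gives closeness `c` of the derivatives by Cauchy's
  -- estimate on circles of radius `s`.
  obtain ⟨η, hη, h⟩ := exists_height_close (B := B) hw (ρ := ρ + s) (c := c * s)
    (by rw [hs]; linarith) (by positivity)
  refine ⟨η, hη, fun w' hw' hww z hz => ?_⟩
  rw [mem_closedBall_zero_iff] at hz
  have hzR : z ∈ ball (0 : ℂ) B.radius := by rw [mem_ball_zero_iff]; linarith
  have hnhds := isOpen_ball.mem_nhds hzR
  have hd := ((differentiableOn_height hw').differentiableAt hnhds)
  have hd' := ((differentiableOn_height hw).differentiableAt hnhds)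
  rw [← deriv_sub hd hd']
  have hsub : closedBall z s ⊆ closedBall 0 (ρ + s) := by
    apply closedBall_subset_closedBall'
    rw [dist_zero_right]; linarith
  have hsub' : closedBall (0 : ℂ) (ρ + s) ⊆ ball 0 B.radius :=
    closedBall_subset_ball (by rw [hs]; linarith)
  have := Complex.norm_deriv_le_of_forall_mem_sphere_norm_le (c := z) (C := c * s)
    (f := B.height w' - B.height w) hs0 ?_ ?_
  · rwa [mul_div_cancel_right₀ _ hs0.ne'] at this
  · apply DifferentiableOn.diffContOnCl
    rw [closure_ball z hs0.ne']
    exact ((differentiableOn_height hw').sub (differentiableOn_height hw)).mono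
      (hsub.trans hsub')
  · intro y hy
    exact (h w' hw' hww y (hsub (sphere_subset_closedBall hy))).le

theorem continuousOn_deriv_height (hw : w ∈ B.transversal) :
    ContinuousOn (deriv (B.height w)) (ball 0 B.radius) :=
  ((differentiableOn_height hw).deriv isOpen_ball).continuousOn

/-- The slope depends continuously on the point of the box. -/
theorem exists_deriv_height_near (hw : w ∈ B.transversal) {ρ c : ℝ} (hρ : ρ < B.radius)
    (hc : 0 < c) : ∃ η > 0, ∀ w' ∈ B.transversal, ‖w' - w‖ < η → ∀ z ∈ closedBall (0 : ℂ) ρ,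
      ∀ z', ‖z' - z‖ < η → z' ∈ ball (0 : ℂ) B.radius ∧
      ‖deriv (B.height w') z' - deriv (B.height w) z‖ ≤ c := by
  set ρ' : ℝ := (ρ + B.radius) / 2 with hρ'
  obtain ⟨η₁, hη₁, h₁⟩ := exists_deriv_height_close (B := B) hw (ρ := ρ') (c := c / 2)
    (by rw [hρ']; linarith) (by positivity)
  have huc := (isCompact_closedBall (0 : ℂ) ρ').uniformContinuousOn_of_continuous
    ((continuousOn_deriv_height hw).mono (closedBall_subset_ball (by rw [hρ']; linarith)))
  rw [Metric.uniformContinuousOn_iff] at huc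
  obtain ⟨η₂, hη₂, h₂⟩ := huc (c / 2) (by positivity)
  have hd : 0 < ρ' - ρ := by rw [hρ']; linarith
  refine ⟨min η₁ (min η₂ (ρ' - ρ)), by positivity, fun w' hw' hww z hz z' hzz => ?_⟩
  simp only [lt_min_iff] at hww hzz
  have hzρ := mem_closedBall_zero_iff.1 hz
  have hz'ρ : ‖z'‖ ≤ ρ' := by
    have := norm_add_le z (z' - z)
    rw [add_sub_cancel] at this
    linarith [hzz.2.2]
  refine ⟨by rw [mem_ball_zero_iff]; linarith, ?_⟩
  have e1 := h₁ w' hw' hww.1 z' (mem_closedBall_zero_iff.2 hz'ρ)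
  have e2 := h₂ z' (mem_closedBall_zero_iff.2 hz'ρ) z
    (mem_closedBall_zero_iff.2 (by linarith)) (by rw [dist_eq_norm]; exact hzz.2.1)
  rw [dist_eq_norm] at e2
  have := norm_add_le (deriv (B.height w') z' - deriv (B.height w) z')
    (deriv (B.height w) z' - deriv (B.height w) z)
  rw [sub_add_sub_cancel] at this
  linarith

/-- Nearby plaques are uniformly bounded on compact subdisks. -/
theorem exists_height_bound (hw : w ∈ B.transversal) {ρ : ℝ} (hρ : ρ < B.radius) :
    ∃ M : ℝ, ∃ η > 0, ∀ w' ∈ B.transversal, ‖w' - w‖ < η → ∀ z ∈ closedBall (0 : ℂ) ρ,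
      ‖B.height w' z‖ ≤ M := by
  obtain ⟨η, hη, h⟩ := exists_height_close (B := B) hw hρ one_pos
  obtain ⟨M, hM⟩ := (isCompact_closedBall (0 : ℂ) ρ).exists_bound_of_continuousOn
    ((differentiableOn_height hw).continuousOn.mono (closedBall_subset_ball hρ))
  refine ⟨M + 1, η, hη, fun w' hw' hww z hz => ?_⟩
  have := norm_add_le (B.height w z) (B.height w' z - B.height w z)
  rw [add_sub_cancel] at this
  linarith [hM z hz, h w' hw' hww z hz]

/-- Nearby plaques are uniformly Lipschitz near a point. -/
theorem exists_height_lipschitz (hw : w ∈ B.transversal) (hz : z ∈ ball (0 : ℂ) B.radius) :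
    ∃ K : ℝ, 0 ≤ K ∧ ∃ η > 0, ∀ w' ∈ B.transversal, ‖w' - w‖ < η →
      ∀ y ∈ ball z η, ∀ y' ∈ ball z η, ‖B.height w' y - B.height w' y'‖ ≤ K * ‖y - y'‖ := by
  rw [mem_ball_zero_iff] at hz
  obtain ⟨η, hη, h⟩ := exists_deriv_height_near (B := B) hw (ρ := ‖z‖) hz one_pos
  refine ⟨‖deriv (B.height w) z‖ + 1, by positivity, η, hη, fun w' hw' hww y hy y' hy' => ?_⟩
  have hmem : ∀ x ∈ ball z η, x ∈ ball (0 : ℂ) B.radius ∧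
      ‖deriv (B.height w') x - deriv (B.height w) z‖ ≤ 1 := fun x hx =>
    h w' hw' hww z (by simp) x (by rwa [mem_ball, dist_eq_norm] at hx)
  refine (convex_ball z η).norm_image_sub_le_of_norm_deriv_le (fun x hx => ?_) (fun x hx => ?_)
    hy' hy
  · exact (differentiableOn_height hw').differentiableAt (isOpen_ball.mem_nhds (hmem x hx).1)
  · have := norm_add_le (deriv (B.height w') x - deriv (B.height w) z) (deriv (B.height w) z)
    rw [sub_add_cancel] at this
    linarith [(hmem x hx).2]

end FlowBox

end TorusLam

/-! ### Near invariance and the count of zeros of the gap. -/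

namespace TorusLam

variable {Λ : Submodule ℤ (ℂ × ℂ)} {X : Set (Torus Λ)}

namespace FlowBox

variable (B : FlowBox Λ X) (v : ℂ × ℂ)

/-- The transverse distance between the plaque `a` and the translate by `ε • v` of the
plaque `b`. -/
def gap (ε a b z : ℂ) : ℂ :=
  B.height a z - B.height b (z - ε * B.dir.tangential v) - ε * B.dir.transverse v

/-- Near the plaque `w` there are plaques which coincide, up to an error smaller than any power of
`ε`, with the translate by `ε • v` of another one. -/
def NearlyInvariant (w : ℂ) : Prop :=
  ∀ ρ < B.radius, ∀ M : ℕ, ∀ η > 0, ∃ ε : ℂ, ε ≠ 0 ∧ ‖ε‖ < η ∧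
    ∃ a ∈ B.transversal, ‖a - w‖ < η ∧ ∃ b ∈ B.transversal, ‖b - w‖ < η ∧
      ∀ z ∈ closedBall (0 : ℂ) ρ, ‖B.gap v ε a b z‖ ≤ ‖ε‖ ^ M

/-- The version of `NearlyInvariant` localized at the point `z₁` of the plaque. -/
def NearlyInvariantAt (w z₁ : ℂ) : Prop :=
  ∃ r > 0, ∀ M : ℕ, ∀ η > 0, ∃ ε : ℂ, ε ≠ 0 ∧ ‖ε‖ < η ∧
    ∃ a ∈ B.transversal, ‖a - w‖ < η ∧ ∃ b ∈ B.transversal, ‖b - w‖ < η ∧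
      ∀ z ∈ ball z₁ r, ‖B.gap v ε a b z‖ ≤ ‖ε‖ ^ M

variable {B v} {w z₁ : ℂ}

theorem norm_mul_tangential_le (d : Direction) (ε : ℂ) :
    ‖ε * d.tangential v‖ ≤ ‖ε‖ * ‖v‖ := by
  rw [norm_mul]
  exact mul_le_mul_of_nonneg_left (Direction.norm_tangential_le v) (norm_nonneg _)

theorem norm_mul_transverse_le (d : Direction) (ε : ℂ) :
    ‖ε * d.transverse v‖ ≤ ‖ε‖ * ‖v‖ := by
  rw [norm_mul]
  exact mul_le_mul_of_nonneg_left (Direction.norm_transverse_le v) (norm_nonneg _)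

/-- Shrinking the disk leaves room for the shift of the argument by `ε * B.dir.tangential v`. Having
`1 ≤ K` ensures that division by `K` does not spoil upper bounds and that `Real.log K` is
nonnegative. -/
theorem exists_gap_bound (hw : w ∈ B.transversal) {ρ : ℝ} (hρ : ρ < B.radius) :
    ∃ K : ℝ, 1 ≤ K ∧ ∃ η > 0, ∀ ε : ℂ, ‖ε‖ < η →
      ∀ a ∈ B.transversal, ‖a - w‖ < η → ∀ b ∈ B.transversal, ‖b - w‖ < η →
      DifferentiableOn ℂ (B.gap v ε a b) (ball 0 ρ) ∧
      ∀ z ∈ ball (0 : ℂ) ρ, ‖B.gap v ε a b z‖ ≤ K := by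
  set s : ℝ := (B.radius - ρ) / 2 with hs
  have hs0 : 0 < s := by rw [hs]; linarith
  have hρs : ρ + s < B.radius := by rw [hs]; linarith
  obtain ⟨M, η, hη, h⟩ := exists_height_bound (B := B) hw hρs
  refine ⟨2 * |M| + s + 1, by have := abs_nonneg M; linarith, min η (s / (‖v‖ + 1)),
    by positivity, ?_⟩
  intro ε hε a ha haw b hb hbw
  simp only [lt_min_iff] at hε haw hbw
  have hεv : ‖ε‖ * ‖v‖ ≤ s := by
    have h1 := (lt_div_iff₀ (by positivity)).1 hε.2
    nlinarith [norm_nonneg ε]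
  have hmem : ∀ z ∈ ball (0 : ℂ) ρ, z ∈ closedBall (0 : ℂ) (ρ + s) ∧
      z - ε * B.dir.tangential v ∈ closedBall (0 : ℂ) (ρ + s) := by
    intro z hz
    rw [mem_ball_zero_iff] at hz
    rw [mem_closedBall_zero_iff, mem_closedBall_zero_iff]
    refine ⟨by linarith, (norm_sub_le _ _).trans ?_⟩
    have := norm_mul_tangential_le (v := v) B.dir ε
    linarith
  constructor
  · refine DifferentiableOn.sub_const (DifferentiableOn.sub ?_ ?_) _
    · exact (differentiableOn_height ha).mono fun z hz =>
        closedBall_subset_ball hρs (hmem z hz).1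
    · exact (differentiableOn_height hb).comp (by fun_prop) fun z hz =>
        closedBall_subset_ball hρs (hmem z hz).2
  · intro z hz
    obtain ⟨h1, h2⟩ := hmem z hz
    have e1 := h a ha haw.1 _ h1
    have e2 := h b hb hbw.1 _ h2
    have e3 := norm_mul_transverse_le (v := v) B.dir ε
    have e4 := norm_sub_le (B.height a z - B.height b (z - ε * B.dir.tangential v))
      (ε * B.dir.transverse v)
    have e5 := norm_sub_le (B.height a z) (B.height b (z - ε * B.dir.tangential v))
    have := le_abs_self M
    rw [gap]
    linarith

theorem NearlyInvariant.at (h : B.NearlyInvariant v w) (hz₁ : z₁ ∈ ball (0 : ℂ) B.radius) :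
    B.NearlyInvariantAt v w z₁ := by
  rw [mem_ball_zero_iff] at hz₁
  refine ⟨(B.radius - ‖z₁‖) / 2, by linarith, fun M η hη => ?_⟩
  obtain ⟨ε, hε, hεη, a, ha, haw, b, hb, hbw, hg⟩ :=
    h ((B.radius + ‖z₁‖) / 2) (by linarith) M η hη
  refine ⟨ε, hε, hεη, a, ha, haw, b, hb, hbw, fun z hz => hg z ?_⟩
  refine ball_subset_closedBall (ball_subset_ball' ?_ hz)
  rw [dist_zero_right]
  linarith

/-- The radius of the small disk is fixed before the power `M`, so a single two-constants exponent
serves all powers. Being smaller than every power of `‖ε‖` survives raising to a fixed positive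
exponent. -/
theorem NearlyInvariantAt.nearlyInvariant (hw : w ∈ B.transversal)
    (hz₁ : z₁ ∈ ball (0 : ℂ) B.radius) (h : B.NearlyInvariantAt v w z₁) :
    B.NearlyInvariant v w := by
  intro ρ hρ M η hη
  obtain ⟨r, hr, h⟩ := h
  rw [mem_ball_zero_iff] at hz₁
  obtain ⟨ρ', hρ', hρ'R⟩ := exists_between (max_lt hρ hz₁)
  have hρρ' := (le_max_left _ _).trans_lt hρ'
  have hzρ' := (le_max_right _ _).trans_lt hρ'
  obtain ⟨θ, hθ0, hθ1, hθ⟩ := exists_exponent_two_constants (z₁ := z₁)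
    (mem_ball_zero_iff.2 hzρ') hr hρρ'
  obtain ⟨K, hK, η', hη', hgap⟩ := exists_gap_bound (v := v) hw hρ'R
  have hK0 : 0 < K := by linarith
  -- The power `N` becomes at least `M + 1` after applying `θ`; the spare factor `‖ε‖` absorbs the
  -- normalizing constant `K`.
  obtain ⟨N, hN⟩ := exists_nat_ge ((M + 1 : ℝ) / θ)
  rw [div_le_iff₀ hθ0] at hN
  obtain ⟨ε, hε, hεη, a, ha, haw, b, hb, hbw, hg⟩ :=
    h N (min η (min η' (min 1 K⁻¹))) (by positivity)
  simp only [lt_min_iff] at hεη haw hbw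
  refine ⟨ε, hε, hεη.1, a, ha, haw.1, b, hb, hbw.1, fun z hz => ?_⟩
  obtain ⟨hd, hbd⟩ := hgap ε hεη.2.1 a ha haw.2.1 b hb hbw.2.1
  have hε0 : 0 < ‖ε‖ := norm_pos_iff.2 hε
  have key := hθ (fun z => B.gap v ε a b z / K) (hd.div_const _) (fun z hz => ?_) (‖ε‖ ^ N)
    (by positivity) (pow_le_one₀ hε0.le hεη.2.2.1.le) (fun z hz => ?_) z hz
  · rw [norm_div, Complex.norm_real, Real.norm_of_nonneg hK0.le, div_le_iff₀ hK0] at key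
    refine key.trans ?_
    have e1 : (‖ε‖ ^ N) ^ θ ≤ ‖ε‖ ^ (M + 1) := by
      rw [← Real.rpow_natCast, ← Real.rpow_natCast, ← Real.rpow_mul hε0.le]
      exact Real.rpow_le_rpow_of_exponent_ge hε0 hεη.2.2.1.le (by push_cast; exact hN)
    have e2 : ‖ε‖ * K ≤ 1 := by
      have := (mul_lt_mul_of_pos_right hεη.2.2.2 hK0).le
      rwa [inv_mul_cancel₀ hK0.ne'] at this
    calc (‖ε‖ ^ N) ^ θ * K ≤ ‖ε‖ ^ (M + 1) * K := by gcongr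
      _ = ‖ε‖ ^ M * (‖ε‖ * K) := by ring
      _ ≤ ‖ε‖ ^ M * 1 := by gcongr
      _ = ‖ε‖ ^ M := mul_one _
  · rw [norm_div, Complex.norm_real, Real.norm_of_nonneg hK0.le, div_le_one hK0]
    exact hbd z hz
  · rw [norm_div, Complex.norm_real, Real.norm_of_nonneg hK0.le]
    exact (div_le_self (norm_nonneg _) hK).trans (hg z hz.1)

end FlowBox

/-- Since `ncard` of an infinite set is 0, finiteness has to be obtained together with the bound;
testing all finite subsets gives both. -/
theorem finite_and_ncard_le {α : Type*} {Z : Set α} {c : ℝ}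
    (h : ∀ S : Finset α, ↑S ⊆ Z → (S.card : ℝ) ≤ c) : Z.Finite ∧ (Z.ncard : ℝ) ≤ c := by
  have hfin : Z.Finite := by
    by_contra hinf
    obtain ⟨n, hn⟩ := exists_nat_gt c
    obtain ⟨S, hS, hcard⟩ := Set.Infinite.exists_subset_card_eq hinf n
    have := h S hS
    rw [hcard] at this
    linarith
  refine ⟨hfin, ?_⟩
  rw [Set.ncard_eq_toFinset_card Z hfin]
  exact h _ (by simp)

namespace FlowBox

variable {B : FlowBox Λ X} {v : ℂ × ℂ} {w z₁ : ℂ}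

/-- Where the lamination is not nearly invariant, the translates of plaques meet plaques in few
points. -/
theorem exists_ncard_gap_le (hw : w ∈ B.transversal) (hz₁ : z₁ ∈ ball (0 : ℂ) B.radius)
    (h : ¬ B.NearlyInvariantAt v w z₁) :
    ∃ η > 0, ∃ A > 0, ∀ ε : ℂ, ε ≠ 0 → ‖ε‖ < η →
      ∀ a ∈ B.transversal, ‖a - w‖ < η → ∀ b ∈ B.transversal, ‖b - w‖ < η →
      {z | z ∈ ball z₁ η ∧ B.gap v ε a b z = 0}.Finite ∧
      ({z | z ∈ ball z₁ η ∧ B.gap v ε a b z = 0}.ncard : ℝ) ≤ A * Real.log (1 / ‖ε‖) := by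
  rw [mem_ball_zero_iff] at hz₁
  obtain ⟨ρ, hρ, hρR⟩ := exists_between hz₁
  set r : ℝ := (ρ - ‖z₁‖) / 8 with hr
  have hr0 : 0 < r := by rw [hr]; linarith
  have hsub : ball z₁ (8 * r) ⊆ ball 0 ρ := by
    apply ball_subset_ball'
    rw [dist_zero_right, hr]
    linarith
  obtain ⟨K, hK, η', hη', hgap⟩ := exists_gap_bound (v := v) hw hρR
  rw [NearlyInvariantAt] at h
  push Not at h
  obtain ⟨M, η₀, hη₀, h⟩ := h r hr0
  have hl2 : 0 < Real.log 2 := Real.log_pos one_lt_two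
  have hlK : 0 ≤ Real.log K := Real.log_nonneg hK
  -- With n zeros, `‖ε‖ ^ M` is less than K / 2 ^ n; taking logarithms bounds n. As `‖ε‖` is below
  -- 1/2, log K is at most (log K / log 2) log(1/|ε|), and the summand 1 makes the constant
  -- positive.
  refine ⟨min η₀ (min η' (min r (1 / 2))), by positivity,
    (Real.log K / Real.log 2 + M + 1) / Real.log 2, by positivity, ?_⟩
  intro ε hε hεη a ha haw b hb hbw
  simp only [lt_min_iff] at hεη haw hbw
  obtain ⟨z, hz, hgz⟩ := h ε hε hεη.1 a ha haw.1 b hb hbw.1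
  obtain ⟨hd, hbd⟩ := hgap ε hεη.2.1 a ha haw.2.1 b hb hbw.2.1
  have hε0 : 0 < ‖ε‖ := norm_pos_iff.2 hε
  refine finite_and_ncard_le fun S hS => ?_
  have hS' : ∀ s ∈ S, s ∈ ball z₁ r ∧ B.gap v ε a b s = 0 := fun s hs =>
    ⟨ball_subset_ball ((min_le_right _ _).trans ((min_le_right _ _).trans (min_le_left _ _)))
      (hS hs).1, (hS hs).2⟩
  have key := norm_le_of_zeros hr0 S _ K (hd.mono hsub) (fun z hz => hbd z (hsub hz)) hS' z hz
  have hlog := Real.log_lt_log (by positivity) (hgz.trans_le key)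
  rw [Real.log_pow, Real.log_mul (by positivity) (by positivity), Real.log_pow, one_div,
    Real.log_inv] at hlog
  rw [one_div, Real.log_inv]
  have hL : Real.log 2 ≤ - Real.log ‖ε‖ := by
    rw [← Real.log_inv]
    refine Real.log_le_log two_pos ?_
    rw [le_inv_comm₀ two_pos hε0]
    linarith [hεη.2.2.2]
  rw [div_mul_eq_mul_div, le_div_iff₀ hl2]
  have e1 : Real.log K ≤ Real.log K / Real.log 2 * (- Real.log ‖ε‖) := by
    rw [div_mul_eq_mul_div, le_div_iff₀ hl2]
    exact mul_le_mul_of_nonneg_left hL hlK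
  nlinarith

end FlowBox

end TorusLam

/-! ### Change of flow box, and transversality of nearly invariant plaques. -/

namespace TorusLam

/-- The determinant of two vectors of `ℂ²`. -/
def det2 (a b : ℂ × ℂ) : ℂ := a.1 * b.2 - a.2 * b.1

theorem det2_smul_right (a b : ℂ × ℂ) (c : ℂ) : det2 a (c • b) = c * det2 a b := by
  simp only [det2, Prod.smul_fst, Prod.smul_snd, smul_eq_mul]; ring

theorem det2_graphPoint_eq_zero_iff (d : Direction) (v : ℂ × ℂ) (m : ℂ) :
    det2 v (d.graphPoint 0 0 1 m) = 0 ↔ d.transverse v - d.tangential v * m = 0 := by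
  cases d
  · simp only [det2, Direction.graphPoint, Direction.transverse, Direction.tangential,
      Prod.fst_zero, zero_add, mul_one]
    constructor <;> intro h <;> linear_combination -h
  · simp only [det2, Direction.graphPoint, Direction.transverse, Direction.tangential,
      Prod.snd_zero, zero_add, mul_one]

/-- In a horizontal box each determinant is minus the corresponding expression on the right, in a
vertical box it equals it; the sign cancels in the quotient. -/
theorem det2_graphPoint_div (d : Direction) (u v : ℂ × ℂ) (m : ℂ) :
    det2 u (d.graphPoint 0 0 1 m) / det2 v (d.graphPoint 0 0 1 m) =
      (d.transverse u - d.tangential u * m) / (d.transverse v - d.tangential v * m) := by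
  cases d
  · simp only [det2, Direction.graphPoint, Direction.transverse, Direction.tangential,
      Prod.fst_zero, zero_add, mul_one]
    rw [← neg_div_neg_eq, neg_sub, neg_sub]
  · simp only [det2, Direction.graphPoint, Direction.transverse, Direction.tangential,
      Prod.snd_zero, zero_add, mul_one]

variable {Λ : Submodule ℤ (ℂ × ℂ)} {X : Set (Torus Λ)}

namespace FlowBox

variable {B C : FlowBox Λ X} {v l : ℂ × ℂ} {w z w' z' : ℂ}

/-- If two boxes overlap at a point, then near this point the plaques of the first one are
contained in those of the second one. -/
theorem OverlapsOpenly.exists_transition (hBC : B.OverlapsOpenly C) (hw : w ∈ B.transversal)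
    (hz : z ∈ ball (0 : ℂ) B.radius) (hw' : w' ∈ C.transversal)
    (hz' : z' ∈ ball (0 : ℂ) C.radius) (hl : l ∈ Λ) (h : B.param w z = C.param w' z' + l) :
    ∃ ρ > 0, ∀ a ∈ B.transversal, ‖a - w‖ < ρ → ∀ a' ∈ C.transversal,
      ∀ ζ ∈ ball (0 : ℂ) C.radius, ∀ y ∈ ball z ρ, B.param a y = C.param a' ζ + l →
      ∀ y₂ ∈ ball z ρ, ∃ ζ₂ ∈ ball (0 : ℂ) C.radius, B.param a y₂ = C.param a' ζ₂ + l := by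
  have hV : (fun y => y - l) ⁻¹' C.domain ∈ 𝓝 (B.param w z) := by
    refine (C.isOpen_domain.preimage (by fun_prop)).mem_nhds ?_
    rw [mem_preimage, h, add_sub_cancel_right]
    exact (param_mem hw' hz').1
  obtain ⟨ρ, hρ, hclose⟩ := exists_param_close hw hz hV
  refine ⟨ρ, hρ, fun a ha haw a' ha' ζ hζ y hy hyζ y₂ hy₂ => ?_⟩
  have hclose' : ∀ x ∈ ball z ρ, x ∈ ball (0 : ℂ) B.radius ∧ B.param a x - l ∈ C.domain :=
    fun x hx => hclose a ha haw x (by rwa [mem_ball, dist_eq_norm] at hx)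
  have hproj : ∀ p : ℂ × ℂ, proj Λ (p - l) = proj Λ p := fun p =>
    (proj_eq_iff.2 ⟨l, hl, by abel⟩).symm
  have heq : ∀ x ∈ ball z ρ, ∀ b ∈ C.transversal, proj Λ (B.param a x) ∈ C.plaque b →
      ∃ ζ ∈ ball (0 : ℂ) C.radius, B.param a x = C.param b ζ + l := by
    rintro x hx b hb ⟨ξ, hξ, hξx⟩
    refine ⟨ξ, hξ, ?_⟩
    rw [← sub_eq_iff_eq_add]
    refine C.injOn_proj (hclose' x hx).2 (param_mem hb hξ).1 ?_
    rw [hproj]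
    exact hξx.symm
  set O : ℂ → Set ℂ := fun b =>
    {x : ℂ | x ∈ ball (0 : ℂ) B.radius ∧ proj Λ (B.param a x) ∈ C.plaque b} with hO
  have hmemO : ∀ x ∈ ball z ρ, ∀ b ζ, ζ ∈ ball (0 : ℂ) C.radius →
      B.param a x = C.param b ζ + l → x ∈ O b := fun x hx b ζ hζ hb =>
    ⟨(hclose' x hx).1, ζ, hζ, (proj_eq_iff.2 ⟨l, hl, hb⟩).symm⟩
  -- The plaques of `C` cut the disk into disjoint open pieces, so by connectedness only one piece
  -- is nonempty. This needs no countability of the transversal.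
  have hpre := isPreconnected_iff_subset_of_disjoint.1 (convex_ball z ρ).isPreconnected (O a')
    (⋃ b ∈ C.transversal \ {a'}, O b) (hBC a ha a' ha')
    (isOpen_biUnion fun b hb => hBC a ha b hb.1) ?_ ?_
  · rcases hpre with h1 | h1
    · exact heq y₂ hy₂ a' ha' (h1 hy₂).2
    · exfalso
      obtain ⟨b, hb, hyb⟩ := mem_iUnion₂.1 (h1 hy)
      obtain ⟨ξ, hξ, hyξ⟩ := heq y hy b hb.1 hyb.2
      rw [hyζ, add_left_inj] at hyξ
      exact hb.2 (param_injective ha' hζ hb.1 hξ hyξ).1.symm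
  · intro x hx
    have hX : proj Λ (B.param a x - l) ∈ X := by
      rw [hproj]; exact (param_mem ha (hclose' x hx).1).2
    obtain ⟨b, hb, ξ, hξ, hbξ⟩ := exists_param (hclose' x hx).2 hX
    have hxb := hmemO x hx b ξ hξ (by rw [hbξ, sub_add_cancel])
    by_cases hba : b = a'
    · left; rwa [← hba]
    · right; exact mem_iUnion₂.2 ⟨b, ⟨hb, hba⟩, hxb⟩
  · rw [eq_empty_iff_forall_notMem]
    rintro x ⟨hx, hxa, hxb⟩
    obtain ⟨b, hb, hxb⟩ := mem_iUnion₂.1 hxb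
    obtain ⟨ξ, hξ, hxξ⟩ := heq x hx a' ha' hxa.2
    obtain ⟨ξ', hξ', hxξ'⟩ := heq x hx b hb.1 hxb.2
    rw [hxξ, add_left_inj] at hxξ'
    exact hb.2 (param_injective ha' hξ hb.1 hξ' hxξ').1.symm

/-- Near invariance does not depend on the flow box. -/
theorem NearlyInvariant.change_box (hB : B.NearlyInvariant v w) (hBC : B.Compatible C)
    (hw : w ∈ B.transversal) (hz : z ∈ ball (0 : ℂ) B.radius) (hw' : w' ∈ C.transversal)
    (hz' : z' ∈ ball (0 : ℂ) C.radius) (hl : l ∈ Λ) (h : B.param w z = C.param w' z' + l) :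
    C.NearlyInvariant v w' := by
  refine NearlyInvariantAt.nearlyInvariant hw' hz' ?_
  have h' : C.param w' z' = B.param w z + -l := by rw [h]; abel
  obtain ⟨ρ, hρ, hT⟩ := hBC.1.exists_transition hw hz hw' hz' hl h
  obtain ⟨ρ', hρ', hT'⟩ := hBC.2.exists_transition hw' hz' hw hz (neg_mem hl) h'
  obtain ⟨r, hr, hB⟩ := hB.at hz
  obtain ⟨K, hK, σ, hσ, hlip⟩ := exists_height_lipschitz hw' hz'
  set m : ℝ := min ρ r with hm
  have hm0 : 0 < m := lt_min hρ hr
  obtain ⟨κ, hκ, hq⟩ := exists_param_close hw' hz' (ball_mem_nhds (C.param w' z') (half_pos hm0))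
  set s : ℝ := min ρ' (min κ σ) / 2 with hs
  have hs0 : 0 < s := by positivity
  have hsρ : 2 * s ≤ ρ' := by rw [hs]; linarith [min_le_left ρ' (min κ σ)]
  have hsκ : 2 * s ≤ κ := by
    rw [hs]; linarith [min_le_right ρ' (min κ σ), min_le_left κ σ]
  have hsσ : 2 * s ≤ σ := by
    rw [hs]; linarith [min_le_right ρ' (min κ σ), min_le_right κ σ]
  refine ⟨s, hs0, fun M η hη => ?_⟩
  obtain ⟨rN, hrN, hnear⟩ := exists_param_near hw' hz' (η := min η (2 * s)) (by positivity)
  obtain ⟨ηc, hηc, hclose⟩ := exists_param_close hw hz (ball_mem_nhds (B.param w z) hrN)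
  obtain ⟨ε, hε, hεη, a, ha, haw, b, hb, hbw, hg⟩ := hB (M + 1)
    (min η (min ρ (min ηc (min 1 (min (K + 1)⁻¹ (min (min s (m / 2) / (‖v‖ + 1)) s))))))
    (by positivity)
  simp only [lt_min_iff] at hεη haw hbw
  have hε0 : 0 < ‖ε‖ := norm_pos_iff.2 hε
  have hεv : ‖ε‖ * ‖v‖ < min s (m / 2) := by
    have := (lt_div_iff₀ (by positivity)).1 hεη.2.2.2.2.2.1
    nlinarith
  have hεs := hεv.trans_le (min_le_left _ _)
  have hεm := hεv.trans_le (min_le_right _ _)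
  have hfind : ∀ c ∈ B.transversal, ‖c - w‖ < ηc → ∃ c' ∈ C.transversal,
      ‖c' - w'‖ < min η (2 * s) ∧ ∃ ζ ∈ ball (0 : ℂ) C.radius, ‖ζ - z'‖ < min η (2 * s) ∧
      B.param c z = C.param c' ζ + l := by
    intro c hc hcw
    obtain ⟨h1, h2⟩ := hclose c hc hcw z (by simpa using hηc)
    have h3 : ‖B.param c z - l - C.param w' z'‖ < rN := by
      rw [mem_ball, dist_eq_norm, h] at h2
      rwa [sub_sub, add_comm l]
    have h4 : proj Λ (B.param c z - l) ∈ X := by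
      rw [show proj Λ (B.param c z - l) = proj Λ (B.param c z) from
        (proj_eq_iff.2 ⟨l, hl, by abel⟩).symm]
      exact (param_mem hc h1).2
    obtain ⟨c', hc', hcw', ζ, hζ, hζz, he⟩ := hnear (B.param c z - l) h3 h4
    exact ⟨c', hc', hcw', ζ, hζ, hζz, by rw [he, sub_add_cancel]⟩
  obtain ⟨a', ha', haw', ζa, hζa, hζaz, hea⟩ := hfind a ha haw.2.2.1
  obtain ⟨b', hb', hbw', ζb, hζb, hζbz, heb⟩ := hfind b hb hbw.2.2.1
  simp only [lt_min_iff] at haw' hbw' hζaz hζbz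
  refine ⟨ε, hε, hεη.1, a', ha', haw'.1, b', hb', hbw'.1, fun y hy => ?_⟩
  rw [mem_ball, dist_eq_norm] at hy
  -- The point of `b'` at which the gap in `C` is evaluated. It is read in `B` as the point `x` of
  -- `b`, moved across the gap of `B` to the plaque `a`, and read again in `C` as the point `ξ` of
  -- `a'`.
  set ζ : ℂ := y - ε * C.dir.tangential v with hζ
  have hζz : ‖ζ - z'‖ < 2 * s := by
    have h1 : ζ - z' = (y - z') - ε * C.dir.tangential v := by rw [hζ]; ring
    rw [h1]
    have := norm_sub_le (y - z') (ε * C.dir.tangential v)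
    have := norm_mul_tangential_le (v := v) C.dir ε
    linarith
  obtain ⟨x, hx, hex⟩ := hT' b' hb' (hbw'.2.trans_le hsρ) b hb z hz ζb
    (by rw [mem_ball, dist_eq_norm]; linarith) (by rw [heb]; abel) ζ
    (by rw [mem_ball, dist_eq_norm]; linarith)
  have hxz : ‖x - z‖ < m / 2 := by
    have h1 := (hq b' hb' (hbw'.2.trans_le hsκ) ζ (hζz.trans_le hsκ)).2
    rw [mem_ball, dist_eq_norm, hex, h'] at h1
    have h2 := Direction.norm_tangential_le (d := B.dir)
      (B.param b x + -l - (B.param w z + -l))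
    have h3 : B.dir.tangential (B.param b x + -l - (B.param w z + -l)) = x - z := by
      simp
    rw [h3] at h2
    exact h2.trans_lt h1
  have hx2 : x + ε * B.dir.tangential v ∈ ball z m := by
    rw [mem_ball, dist_eq_norm]
    have h1 : x + ε * B.dir.tangential v - z = (x - z) + ε * B.dir.tangential v := by ring
    rw [h1]
    have := norm_add_le (x - z) (ε * B.dir.tangential v)
    have := norm_mul_tangential_le (v := v) B.dir ε
    linarith
  obtain ⟨ξ, hξ, heξ⟩ := hT a ha haw.2.1 a' ha' ζa hζa z (mem_ball_self hρ) hea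
    (x + ε * B.dir.tangential v) (ball_subset_ball (min_le_left _ _) hx2)
  -- `D` is purely transverse in `B` but generally oblique in `C`. Its tangential part in `C`
  -- displaces `ξ` from `y`; the Lipschitz bound converts this into a height error, and the extra
  -- power of `ε` absorbs the factor `K + 1`.
  set D : ℂ × ℂ := B.param a (x + ε * B.dir.tangential v) - B.param b x - ε • v with hD
  have hD1 : ‖D‖ ≤ ‖ε‖ ^ (M + 1) := by
    rw [Direction.norm_eq_max (d := B.dir), max_le_iff]
    constructor
    · have : B.dir.tangential D = 0 := by
        rw [hD]; simp
      rw [this, norm_zero]; positivity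
    · have h1 := hg _ (ball_subset_ball (min_le_right _ _) hx2)
      rw [gap, add_sub_cancel_right] at h1
      rw [hD]
      simpa using h1
  have hD2 : D = C.param a' ξ - C.param b' ζ - ε • v := by rw [hD, heξ, hex]; abel
  have hDt : ξ - y = C.dir.tangential D := by rw [hD2, hζ]; simp; ring
  have hDn : C.height a' ξ - C.height b' ζ - ε * C.dir.transverse v = C.dir.transverse D := by
    rw [hD2]; simp
  have hξy : ‖ξ - y‖ ≤ ‖ε‖ ^ (M + 1) := by
    rw [hDt]; exact (Direction.norm_tangential_le D).trans hD1
  have hpow : ‖ε‖ ^ (M + 1) ≤ ‖ε‖ := by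
    simpa using pow_le_pow_of_le_one hε0.le hεη.2.2.2.1.le (show 1 ≤ M + 1 by omega)
  have hl1 := hlip a' ha' (haw'.2.trans_le hsσ) y (by rw [mem_ball, dist_eq_norm]; linarith) ξ (by
    rw [mem_ball, dist_eq_norm]
    have := norm_add_le (ξ - y) (y - z')
    rw [sub_add_sub_cancel] at this
    linarith [hεη.2.2.2.2.2.2])
  have hgap : C.gap v ε a' b' y = (C.height a' y - C.height a' ξ) + C.dir.transverse D := by
    rw [← hDn, gap]; ring
  rw [hgap]
  have hK1 : (K + 1) * ‖ε‖ ≤ 1 := by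
    have := mul_lt_mul_of_pos_left hεη.2.2.2.2.1 (show 0 < K + 1 by linarith)
    rw [mul_inv_cancel₀ (by linarith : K + 1 ≠ 0)] at this
    exact this.le
  rw [norm_sub_rev y ξ] at hl1
  have h5 := Direction.norm_transverse_le (d := C.dir) D
  calc ‖(C.height a' y - C.height a' ξ) + C.dir.transverse D‖
      ≤ ‖C.height a' y - C.height a' ξ‖ + ‖C.dir.transverse D‖ := norm_add_le _ _
    _ ≤ K * ‖ε‖ ^ (M + 1) + ‖ε‖ ^ (M + 1) :=
        add_le_add (hl1.trans (mul_le_mul_of_nonneg_left hξy hK)) (h5.trans hD1)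
    _ = ‖ε‖ ^ M * ((K + 1) * ‖ε‖) := by ring
    _ ≤ ‖ε‖ ^ M * 1 := by gcongr
    _ = ‖ε‖ ^ M := mul_one _

variable (B) in
/-- The tangent vector of the plaque `w` at `ψ (z, w)`. -/
noncomputable def tangent (w z : ℂ) : ℂ × ℂ := B.dir.graphPoint 0 0 1 (deriv (B.height w) z)

theorem hasDerivAt_param (hw : w ∈ B.transversal) (hz : z ∈ ball (0 : ℂ) B.radius) :
    HasDerivAt (B.param w) (B.tangent w z) z := by
  have h1 : HasDerivAt (B.height w) (deriv (B.height w) z) z :=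
    ((differentiableOn_height hw).differentiableAt (isOpen_ball.mem_nhds hz)).hasDerivAt
  have h2 : ∀ c : ℂ, HasDerivAt (fun z => c + z) 1 z := fun c => (hasDerivAt_id z).const_add c
  have h3 : B.param w = fun z => B.dir.graphPoint B.center w z (B.f w z) := rfl
  rw [h3, tangent]
  rcases hd : B.dir
  · simp only [Direction.graphPoint, Prod.fst_zero, zero_add]
    exact (h2 B.center.1).prodMk h1
  · simp only [Direction.graphPoint, Prod.snd_zero, zero_add]
    exact h1.prodMk (h2 B.center.2)

theorem tangent_ne_zero : B.tangent w z ≠ 0 := by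
  intro h
  have h1 : B.dir.tangential (B.tangent w z) = B.dir.tangential 0 := by rw [h]
  rw [tangent, Direction.tangential_graphPoint] at h1
  simp at h1

/-- The tangent direction does not depend on the flow box. -/
theorem OverlapsOpenly.exists_tangent_eq_smul (hBC : B.OverlapsOpenly C)
    (hw : w ∈ B.transversal) (hz : z ∈ ball (0 : ℂ) B.radius) (hw' : w' ∈ C.transversal)
    (hz' : z' ∈ ball (0 : ℂ) C.radius) (hl : l ∈ Λ) (h : B.param w z = C.param w' z' + l) :
    ∃ c : ℂ, c ≠ 0 ∧ B.tangent w z = c • C.tangent w' z' := by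
  obtain ⟨ρ, hρ, hT⟩ := hBC.exists_transition hw hz hw' hz' hl h
  have hT := hT w hw (by simpa using hρ) w' hw' z' hz' z (mem_ball_self hρ) h
  set k : ℂ := C.dir.tangential C.center + C.dir.tangential l with hk
  set ζ : ℂ → ℂ := fun y => C.dir.tangential (B.param w y) - k with hζ
  have hB := hasDerivAt_param hw hz
  have hζd : HasDerivAt ζ (C.dir.tangential (B.tangent w z)) z := by
    have h1 : HasDerivAt (fun y => C.dir.tangential (B.param w y))
        (C.dir.tangential (B.tangent w z)) z := by
      rcases C.dir
      · exact (hasFDerivAt_fst (𝕜 := ℂ) (p := B.param w z)).comp_hasDerivAt z hB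
      · exact (hasFDerivAt_snd (𝕜 := ℂ) (p := B.param w z)).comp_hasDerivAt z hB
    exact h1.sub_const k
  have hζz : ζ z = z' := by simp [hζ, hk, h]
  have hev : B.param w =ᶠ[𝓝 z] fun y => C.param w' (ζ y) + l := by
    filter_upwards [ball_mem_nhds z hρ] with y hy
    obtain ⟨ξ, hξ, he⟩ := hT y hy
    have : ζ y = ξ := by simp [hζ, hk, he]
    rw [this, he]
  have hC : HasDerivAt (C.param w') (C.tangent w' z') (ζ z) := by
    rw [hζz]; exact hasDerivAt_param hw' hz'
  have h2 := ((hC.scomp z hζd).add_const l).congr_of_eventuallyEq hev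
  have h3 := hB.unique h2
  refine ⟨_, ?_, h3⟩
  intro h0
  rw [h0, zero_smul] at h3
  exact tangent_ne_zero h3

end FlowBox

variable {L : Lamination Λ} {B : FlowBox Λ L.carrier} {v : ℂ × ℂ} {w z₀ : ℂ}

/-- A plaque of constant slope is a complex line segment. -/
theorem hasInvariantLineSegments_of_deriv_height (hw : w ∈ B.transversal)
    (hz₀ : z₀ ∈ ball (0 : ℂ) B.radius) {m : ℂ}
    (h : ∀ᶠ z in 𝓝 z₀, deriv (B.height w) z = m) : L.HasInvariantLineSegments := by
  obtain ⟨r, hr, hball⟩ := Metric.eventually_nhds_iff_ball.1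
    (h.and (isOpen_ball.mem_nhds hz₀))
  have hlin : ∀ z ∈ ball z₀ r, B.height w z = B.height w z₀ + (z - z₀) * m := by
    intro z hz
    have hd : ∀ x ∈ ball z₀ r, HasDerivAt (fun x => B.height w x - x * m) 0 x := by
      intro x hx
      have h1 := ((FlowBox.differentiableOn_height hw).differentiableAt
        (isOpen_ball.mem_nhds (hball x hx).2)).hasDerivAt
      rw [(hball x hx).1] at h1
      have h2 := h1.sub ((hasDerivAt_id x).mul_const m)
      rw [one_mul, sub_self] at h2
      exact h2
    have := (convex_ball z₀ r).norm_image_sub_le_of_norm_deriv_le (C := 0)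
      (fun x hx => (hd x hx).differentiableAt) (fun x hx => by rw [(hd x hx).deriv, norm_zero])
      (mem_ball_self hr) hz
    rw [zero_mul, norm_le_zero_iff] at this
    linear_combination this
  set τ : ℂ × ℂ := B.dir.graphPoint 0 0 1 m with hτ
  have hτt : B.dir.tangential τ = 1 := by
    have : B.dir.tangential (0 : ℂ × ℂ) = 0 := by cases B.dir <;> rfl
    rw [hτ, Direction.tangential_graphPoint, this, zero_add]
  have hτn : B.dir.transverse τ = m := by
    rw [hτ, Direction.transverse_graphPoint, zero_add]
  have hτ0 : τ ≠ 0 := by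
    intro h0
    rw [h0] at hτt
    cases hB : B.dir <;> simp [hB, Direction.tangential] at hτt
  refine ⟨AffineSubspace.mk' (B.param w z₀) (Submodule.span ℂ {τ}),
    {q | B.dir.tangential q - B.dir.tangential B.center ∈ ball z₀ r}, ?_, ?_, ?_, ?_⟩
  · rw [AffineSubspace.direction_mk']
    exact finrank_span_singleton hτ0
  · exact isOpen_ball.preimage (by fun_prop)
  · exact ⟨B.param w z₀, AffineSubspace.self_mem_mk' _ _, by
      rw [mem_ofPred_eq, FlowBox.tangential_param, add_sub_cancel_left]
      exact mem_ball_self hr⟩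
  · rintro q ⟨hq, hqU⟩
    rw [SetLike.mem_coe, AffineSubspace.mem_mk', Submodule.mem_span_singleton] at hq
    obtain ⟨c, hc⟩ := hq
    have hq : q = c • τ + B.param w z₀ := by rw [hc, vsub_eq_sub, sub_add_cancel]
    have hz : z₀ + c ∈ ball z₀ r := by
      simp only [mem_ofPred_eq, hq, Direction.tangential_add, Direction.tangential_smul, hτt,
        FlowBox.tangential_param] at hqU
      convert hqU using 1
      ring
    have : q = B.param w (z₀ + c) := by
      refine Direction.ext_coord (d := B.dir) ?_ ?_
      · simp only [hq, Direction.tangential_add, Direction.tangential_smul, hτt,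
          FlowBox.tangential_param]
        ring
      · simp only [hq, Direction.transverse_add, Direction.transverse_smul, hτn,
          FlowBox.transverse_param, hlin _ hz]
        ring
    rw [this]
    exact (FlowBox.param_mem hw (hball _ hz).2).2

/-- A nearly invariant plaque is nowhere tangent to the direction of the translations. -/
theorem FlowBox.NearlyInvariant.det2_tangent_ne_zero (hL : ¬ L.HasInvariantLineSegments)
    (hv : v ≠ 0) (hw : w ∈ B.transversal) (hz₀ : z₀ ∈ ball (0 : ℂ) B.radius)
    (h : B.NearlyInvariant v w) : det2 v (B.tangent w z₀) ≠ 0 := by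
  rw [FlowBox.tangent, Ne, det2_graphPoint_eq_zero_iff]
  intro h0
  -- The zeros of `φ` are the tangencies with `v`. If `φ` vanishes near `z₀`, the slope is constant
  -- there; otherwise the tangency is isolated and Hurwitz applies.
  set φ : ℂ → ℂ := fun z => B.dir.transverse v - B.dir.tangential v * deriv (B.height w) z with hφ
  have hφd : DifferentiableOn ℂ φ (ball 0 B.radius) :=
    (differentiableOn_const _).sub
      (((FlowBox.differentiableOn_height hw).deriv isOpen_ball).const_mul _)
  rcases (hφd.analyticAt (isOpen_ball.mem_nhds hz₀)).eventually_eq_zero_or_eventually_ne_zero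
    with hev | hev
  · have hvt : B.dir.tangential v ≠ 0 := by
      intro hvt
      rw [hvt, zero_mul, sub_zero] at h0
      apply hv
      refine Direction.ext_coord (d := B.dir) ?_ ?_
      · rw [hvt]; cases B.dir <;> rfl
      · rw [h0]; cases B.dir <;> rfl
    refine hL (hasInvariantLineSegments_of_deriv_height hw hz₀
      (m := B.dir.transverse v / B.dir.tangential v) ?_)
    filter_upwards [hev] with z hz
    rw [eq_div_iff hvt]
    linear_combination -hz
  rw [eventually_nhdsWithin_iff] at hev
  obtain ⟨r, hr, hball⟩ := Metric.eventually_nhds_iff_ball.1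
    (hev.and (isOpen_ball.mem_nhds hz₀))
  rw [mem_ball_zero_iff] at hz₀
  set s : ℝ := min (r / 2) ((B.radius - ‖z₀‖) / 2) with hs
  have hs0 : 0 < s := lt_min (by linarith) (by linarith)
  have hsr : s < r := (min_le_left _ _).trans_lt (by linarith)
  have hsR : s ≤ (B.radius - ‖z₀‖) / 2 := min_le_right _ _
  have hρR : ‖z₀‖ + s < B.radius := by linarith
  have hsub : closedBall z₀ s ⊆ closedBall 0 (‖z₀‖ + s) :=
    closedBall_subset_closedBall' (by rw [dist_zero_right]; linarith)
  have hsubR : closedBall z₀ s ⊆ ball 0 B.radius := hsub.trans (closedBall_subset_ball hρR)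
  obtain ⟨x, hx, hmin⟩ := (isCompact_sphere z₀ s).exists_isMinOn
    (NormedSpace.sphere_nonempty.2 hs0.le)
    (hφd.continuousOn.norm.mono (sphere_subset_closedBall.trans hsubR))
  set c : ℝ := ‖φ x‖ with hc
  have hc0 : 0 < c := by
    refine norm_pos_iff.2 ((hball x ?_).1 ?_)
    · rw [mem_sphere] at hx; rw [mem_ball]; linarith
    · intro hxz
      rw [mem_singleton_iff.1 hxz, mem_sphere, dist_self] at hx
      linarith
  obtain ⟨η, hη, hder⟩ := FlowBox.exists_deriv_height_near (B := B) hw (ρ := ‖z₀‖ + s)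
    (c := c / 8 / (‖v‖ + 1)) hρR (by positivity)
  obtain ⟨ε, hε, hεη, a, ha, haw, b, hb, hbw, hg⟩ := h (‖z₀‖ + s) hρR 2
    (min η (min (c / 8) (η / (‖v‖ + 1)))) (by positivity)
  simp only [lt_min_iff] at hεη haw hbw
  have hε0 : 0 < ‖ε‖ := norm_pos_iff.2 hε
  -- To first order in `ε`, translating the graph of `b` by `ε • v` raises its height by `ε * φ`,
  -- and the graph of `a` nearly coincides with that translate. A gap of order `‖ε‖ ^ 2` suffices.
  have hclose : ∀ z ∈ closedBall z₀ s, ‖(B.height a z - B.height b z) / ε - φ z‖ < c / 2 := by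
    intro z hz
    set t : ℂ := ε * B.dir.tangential v with ht
    have htv : ‖t‖ ≤ ‖ε‖ * ‖v‖ := FlowBox.norm_mul_tangential_le B.dir ε
    have htη : ‖t‖ < η := by
      refine htv.trans_lt ?_
      have := (lt_div_iff₀ (by positivity)).1 hεη.2.2
      nlinarith
    have hd : ∀ y ∈ ball z η, HasDerivAt
        (fun y => B.height b y - y * deriv (B.height w) z)
        (deriv (B.height b) y - deriv (B.height w) z) y := by
      intro y hy
      have h1 := ((FlowBox.differentiableOn_height hb).differentiableAt (isOpen_ball.mem_nhds
        (hder b hb hbw.1 z (hsub hz) y (by rwa [mem_ball, dist_eq_norm] at hy)).1)).hasDerivAt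
      have h2 := h1.sub ((hasDerivAt_id y).mul_const (deriv (B.height w) z))
      rw [one_mul] at h2
      exact h2
    have hmv := (convex_ball z η).norm_image_sub_le_of_norm_deriv_le
      (C := c / 8 / (‖v‖ + 1)) (y := z - t)
      (fun y hy => (hd y hy).differentiableAt) (fun y hy => by
        rw [(hd y hy).deriv]
        exact (hder b hb hbw.1 z (hsub hz) y (by rwa [mem_ball, dist_eq_norm] at hy)).2)
      (mem_ball_self hη) (by rw [mem_ball, dist_eq_norm, sub_sub_cancel_left, norm_neg]; exact htη)
    rw [sub_sub_cancel_left, norm_neg] at hmv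
    have hmv' : c / 8 / (‖v‖ + 1) * ‖t‖ ≤ c / 8 * ‖ε‖ := by
      rw [div_mul_eq_mul_div, div_le_iff₀ (by positivity)]
      have : c / 8 * ‖t‖ ≤ c / 8 * (‖ε‖ * ‖v‖) := by gcongr
      have : 0 < c / 8 * ‖ε‖ := by positivity
      nlinarith
    have hgz := hg z (hsub hz)
    have hid : (B.height a z - B.height b z) / ε - φ z = (B.gap v ε a b z +
        ((B.height b (z - t) - (z - t) * deriv (B.height w) z) -
          (B.height b z - z * deriv (B.height w) z))) / ε := by
      rw [hφ, FlowBox.gap, ← ht, eq_div_iff hε, sub_mul, div_mul_cancel₀ _ hε, ht]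
      ring
    rw [hid, norm_div, div_lt_iff₀ hε0]
    have h1 : ‖ε‖ ^ 2 ≤ c / 8 * ‖ε‖ := by
      rw [sq]; exact mul_le_mul_of_nonneg_right hεη.2.1.le hε0.le
    have h2 := norm_add_le (B.gap v ε a b z)
      ((B.height b (z - t) - (z - t) * deriv (B.height w) z) -
          (B.height b z - z * deriv (B.height w) z))
    have h3 : 0 < c * ‖ε‖ := by positivity
    linarith
  obtain ⟨y, hy, hy0⟩ := exists_eq_zero_of_close (φ := φ) hs0 h0 (fun z hz => hmin hz)
    (((((FlowBox.differentiableOn_height ha).sub (FlowBox.differentiableOn_height hb)).mono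
      hsubR).div_const ε)) hclose
  have hab : B.height a y = B.height b y := by
    rcases div_eq_zero_iff.1 hy0 with h1 | h1
    · exact sub_eq_zero.1 h1
    · exact absurd h1 hε
  -- The zero found is a common point of two plaques, which must then be equal. The difference of
  -- heights is thus identically zero, contradicting its closeness to `φ` at `x`, where `‖φ x‖ = c`.
  have : a = b := by
    refine (FlowBox.param_injective ha (hsubR hy) hb (hsubR hy) ?_).1
    exact Direction.ext_coord (d := B.dir) (by simp) (by simpa using hab)
  have h1 := hclose x (sphere_subset_closedBall hx)
  rw [this, sub_self, zero_div, zero_sub, norm_neg] at h1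
  linarith

end TorusLam

/-! ### The compact set of nearly invariant points and the slope on it. -/

namespace TorusLam

variable {Λ : Submodule ℤ (ℂ × ℂ)} {L : Lamination Λ} {u v : ℂ × ℂ}

namespace Lamination

variable (L v) in
/-- The points of the lamination whose plaques are nearly invariant in the direction `v`. -/
def nearlyInvariantSet : Set (Torus Λ) :=
  {x | ∃ B ∈ L.atlas, ∃ w ∈ B.transversal, ∃ z ∈ ball (0 : ℂ) B.radius,
    proj Λ (B.param w z) = x ∧ B.NearlyInvariant v w}

theorem nearlyInvariant_of_mem {B : FlowBox Λ L.carrier} (hB : B ∈ L.atlas) {w z : ℂ}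
    (hw : w ∈ B.transversal) (hz : z ∈ ball (0 : ℂ) B.radius)
    (h : proj Λ (B.param w z) ∈ L.nearlyInvariantSet v) : B.NearlyInvariant v w := by
  obtain ⟨C, hC, w', hw', z', hz', heq, hn⟩ := h
  obtain ⟨l, hl, heq⟩ := proj_eq_iff.1 heq
  exact hn.change_box (L.compatible C hC B hB) hw' hz' hw hz hl heq

theorem exists_param_of_mem {x : Torus Λ} (hx : x ∈ L.carrier) :
    ∃ B ∈ L.atlas, ∃ w ∈ B.transversal, ∃ z ∈ ball (0 : ℂ) B.radius,
      proj Λ (B.param w z) = x := by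
  obtain ⟨B, hB, p, hp, rfl⟩ := L.covers x hx
  obtain ⟨w, hw, z, hz, rfl⟩ := FlowBox.exists_param hp hx
  exact ⟨B, hB, w, hw, z, hz, rfl⟩

theorem nearlyInvariantSet_subset : L.nearlyInvariantSet v ⊆ L.carrier := by
  rintro _ ⟨B, hB, w, hw, z, hz, rfl, -⟩
  exact (FlowBox.param_mem hw hz).2

/-- Points of the carrier near a point of a flow box are in this box, with close coordinates. -/
theorem eventually_exists_param {B : FlowBox Λ L.carrier} {w z : ℂ}
    (hw : w ∈ B.transversal) (hz : z ∈ ball (0 : ℂ) B.radius) {η : ℝ} (hη : 0 < η) :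
    ∀ᶠ x in 𝓝 (proj Λ (B.param w z)), x ∈ L.carrier → ∃ w' ∈ B.transversal, ‖w' - w‖ < η ∧
      ∃ z' ∈ ball (0 : ℂ) B.radius, ‖z' - z‖ < η ∧ proj Λ (B.param w' z') = x := by
  obtain ⟨r, hr, h⟩ := FlowBox.exists_param_near hw hz hη
  filter_upwards [isOpenMap_proj.image_mem_nhds (ball_mem_nhds (B.param w z) hr)]
  rintro _ ⟨y, hy, rfl⟩ hyX
  obtain ⟨w', hw', hww, z', hz', hzz, rfl⟩ := h y (by rwa [mem_ball, dist_eq_norm] at hy) hyX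
  exact ⟨w', hw', hww, z', hz', hzz, rfl⟩

/-- Near invariance of `w` asks only for pairs of plaques close to `w`, not for `w` itself, so pairs
close to a nearby nearly invariant plaque serve as well: the condition is closed in the carrier. -/
theorem isCompact_nearlyInvariantSet : IsCompact (L.nearlyInvariantSet v) := by
  have : L.nearlyInvariantSet v = L.carrier ∩ closure (L.nearlyInvariantSet v) := by
    refine Subset.antisymm (subset_inter nearlyInvariantSet_subset subset_closure) ?_
    rintro x ⟨hx, hxc⟩
    obtain ⟨B, hB, w, hw, z, hz, rfl⟩ := exists_param_of_mem hx
    refine ⟨B, hB, w, hw, z, hz, rfl, fun ρ hρ M η hη => ?_⟩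
    obtain ⟨y, hyK, hy⟩ := ((mem_closure_iff_frequently.1 hxc).and_eventually
      (eventually_exists_param hw hz (half_pos hη))).exists
    obtain ⟨w', hw', hww, z', hz', -, rfl⟩ := hy (nearlyInvariantSet_subset hyK)
    obtain ⟨ε, hε, hεη, a, ha, haw, b, hb, hbw, hg⟩ :=
      nearlyInvariant_of_mem hB hw' hz' hyK ρ hρ M (η / 2) (half_pos hη)
    have htri : ∀ c : ℂ, ‖c - w'‖ < η / 2 → ‖c - w‖ < η := fun c hc => by
      have := norm_add_le (c - w') (w' - w)
      rw [sub_add_sub_cancel] at this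
      linarith
    exact ⟨ε, hε, by linarith, a, ha, htri a haw, b, hb, htri b hbw, hg⟩
  rw [this]
  exact L.isCompact_carrier.inter_right isClosed_closure

end Lamination

theorem ne_zero_of_det2_ne_zero (huv : det2 u v ≠ 0) : v ≠ 0 := by
  rintro rfl
  simp [det2] at huv

/-- The slope of the plaque `w`, relative to the vectors `u` and `v`. -/
noncomputable def FlowBox.slope {X : Set (Torus Λ)} (B : FlowBox Λ X) (u v : ℂ × ℂ) (w z : ℂ) : ℂ :=
  det2 u (B.tangent w z) / det2 v (B.tangent w z)

theorem FlowBox.slope_eq {X : Set (Torus Λ)} (B : FlowBox Λ X) (w z : ℂ) :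
    B.slope u v w z = (B.dir.transverse u - B.dir.tangential u * deriv (B.height w) z) /
      (B.dir.transverse v - B.dir.tangential v * deriv (B.height w) z) :=
  det2_graphPoint_div _ _ _ _

namespace Lamination

/-- Tangent vectors in two boxes are proportional, and the slope is homogeneous of degree 0. It is a
projective coordinate on directions, with its pole at `v` when `u` and `v` are independent. -/
theorem slope_eq_slope {B C : FlowBox Λ L.carrier} (hB : B ∈ L.atlas) (hC : C ∈ L.atlas)
    {w z w' z' : ℂ} (hw : w ∈ B.transversal) (hz : z ∈ ball (0 : ℂ) B.radius)
    (hw' : w' ∈ C.transversal) (hz' : z' ∈ ball (0 : ℂ) C.radius)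
    (h : proj Λ (B.param w z) = proj Λ (C.param w' z')) :
    B.slope u v w z = C.slope u v w' z' := by
  obtain ⟨l, hl, h⟩ := proj_eq_iff.1 h
  obtain ⟨c, hc, he⟩ := (L.compatible B hB C hC).1.exists_tangent_eq_smul hw hz hw' hz' hl h
  rw [FlowBox.slope, FlowBox.slope, he, det2_smul_right, det2_smul_right,
    mul_div_mul_left _ _ hc]

/-- In a lamination without invariant complex line segments no plaque is nearly invariant. -/
theorem nearlyInvariantSet_eq_empty (hL : ¬ L.HasInvariantLineSegments) (huv : det2 u v ≠ 0) :
    L.nearlyInvariantSet v = ∅ := by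
  have hv : v ≠ 0 := ne_zero_of_det2_ne_zero huv
  have hS : ∀ x ∈ L.nearlyInvariantSet v, ∃ s : ℂ, ∀ B ∈ L.atlas, ∀ w ∈ B.transversal,
      ∀ z ∈ ball (0 : ℂ) B.radius, proj Λ (B.param w z) = x → B.slope u v w z = s := by
    rintro _ ⟨B, hB, w, hw, z, hz, rfl, -⟩
    exact ⟨B.slope u v w z, fun C hC w' hw' z' hz' h => slope_eq_slope hC hB hw' hz' hw hz h⟩
  choose! S hS using hS
  have hden : ∀ B ∈ L.atlas, ∀ w ∈ B.transversal, ∀ z ∈ ball (0 : ℂ) B.radius,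
      B.NearlyInvariant v w →
      B.dir.transverse v - B.dir.tangential v * deriv (B.height w) z ≠ 0 := by
    intro B hB w hw z hz hn h0
    exact hn.det2_tangent_ne_zero hL hv hw hz ((det2_graphPoint_eq_zero_iff _ _ _).2 h0)
  have hcont : ContinuousOn S (L.nearlyInvariantSet v) := by
    rintro x hxK
    obtain ⟨B, hB, w, hw, z, hz, rfl, hn⟩ := id hxK
    have hz' := mem_ball_zero_iff.1 hz
    have hg : ContinuousAt (fun m : ℂ => (B.dir.transverse u - B.dir.tangential u * m) /
        (B.dir.transverse v - B.dir.tangential v * m)) (deriv (B.height w) z) :=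
      ContinuousAt.div (by fun_prop) (by fun_prop) (hden B hB w hw z hz hn)
    rw [ContinuousWithinAt, Metric.tendsto_nhds]
    intro e he
    obtain ⟨δ, hδ, hgδ⟩ := Metric.continuousAt_iff.1 hg e he
    obtain ⟨η, hη, hder⟩ := FlowBox.exists_deriv_height_near hw hz' (half_pos hδ)
    filter_upwards [mem_nhdsWithin_of_mem_nhds (eventually_exists_param hw hz hη),
      self_mem_nhdsWithin] with y hy hyK
    obtain ⟨w', hw', hww, z', hz', hzz, hyy⟩ := hy (nearlyInvariantSet_subset hyK)
    rw [← hS _ hyK B hB w' hw' z' hz' hyy, ← hS _ hxK B hB w hw z hz rfl, B.slope_eq, B.slope_eq]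
    refine hgδ ?_
    rw [dist_eq_norm]
    linarith [(hder w' hw' hww z (by simp) z' hzz).2]
  by_contra hne
  -- The whole plaque through a maximum point lies in the set, so the modulus of the holomorphic
  -- slope has a local maximum along it and the slope is locally constant.
  obtain ⟨x, hxK, hmax⟩ := isCompact_nearlyInvariantSet.exists_isMaxOn
    (nonempty_iff_ne_empty.2 hne) hcont.norm
  obtain ⟨B, hB, w, hw, z₀, hz₀, rfl, hn⟩ := id hxK
  have hnhds := isOpen_ball.mem_nhds hz₀
  have hd : DifferentiableOn ℂ (B.slope u v w) (ball 0 B.radius) := by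
    have hder := (FlowBox.differentiableOn_height hw).deriv isOpen_ball
    have h1 : DifferentiableOn ℂ (fun z =>
        (B.dir.transverse u - B.dir.tangential u * deriv (B.height w) z) /
        (B.dir.transverse v - B.dir.tangential v * deriv (B.height w) z)) (ball 0 B.radius) :=
      DifferentiableOn.div ((differentiableOn_const _).sub (hder.const_mul _))
        ((differentiableOn_const _).sub (hder.const_mul _))
        (fun z hz => hden B hB w hw z hz hn)
    exact h1.congr fun z _ => B.slope_eq w z
  have hloc : IsLocalMax (norm ∘ B.slope u v w) z₀ := by
    filter_upwards [hnhds] with z hz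
    have hzK : proj Λ (B.param w z) ∈ L.nearlyInvariantSet v := ⟨B, hB, w, hw, z, hz, rfl, hn⟩
    have := hmax hzK
    simp only [mem_ofPred_eq] at this
    rwa [← hS _ hzK B hB w hw z hz rfl, ← hS _ hxK B hB w hw z₀ hz₀ rfl] at this
  have hconst := Complex.eventually_eq_of_isLocalMax_norm
    (hd.eventually_differentiableAt hnhds) hloc
  set k : ℂ := B.slope u v w z₀ with hk
  have hlin : ∀ᶠ z in 𝓝 z₀, (B.dir.tangential u - k * B.dir.tangential v) *
      deriv (B.height w) z = B.dir.transverse u - k * B.dir.transverse v := by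
    filter_upwards [hconst, hnhds] with z hz hzR
    rw [B.slope_eq, div_eq_iff (hden B hB w hw z hzR hn)] at hz
    linear_combination -hz
  -- If this coefficient vanished, so would the right-hand side of `hlin`, making `u` a multiple of
  -- `v`.
  have hcoef : B.dir.tangential u - k * B.dir.tangential v ≠ 0 := by
    intro h0
    have h1 := hlin.self_of_nhds
    rw [h0, zero_mul] at h1
    have huk : u = k • v := by
      refine Direction.ext_coord (d := B.dir) ?_ ?_
      · rw [Direction.tangential_smul]; linear_combination h0
      · rw [Direction.transverse_smul]; linear_combination -h1
    apply huv
    rw [huk]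
    simp only [det2, Prod.smul_fst, Prod.smul_snd, smul_eq_mul]
    ring
  refine hL (hasInvariantLineSegments_of_deriv_height hw hz₀
    (m := (B.dir.transverse u - k * B.dir.transverse v) /
      (B.dir.tangential u - k * B.dir.tangential v)) ?_)
  filter_upwards [hlin] with z hz
  rw [eq_div_iff hcoef]
  linear_combination hz

end Lamination

end TorusLam

/-! ### Shrinking flow boxes, and passing from zeros of the gap to intersections in the torus. -/

namespace TorusLam

variable {Λ : Submodule ℤ (ℂ × ℂ)} {X : Set (Torus Λ)}

theorem Direction.continuous_graphPoint (d : Direction) (p : ℂ × ℂ) :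
    Continuous fun w => d.graphPoint p w 0 0 := by
  cases d <;> simp only [Direction.graphPoint] <;> fun_prop

namespace FlowBox

/-- A smaller flow box, centered at a given point of a flow box. -/
theorem exists_recenter (B : FlowBox Λ X) {w₀ z₀ : ℂ} (hw₀ : w₀ ∈ B.transversal) {r s : ℝ}
    (hr : 0 < r) (hs : 0 < s) (hsub : ball z₀ r ⊆ ball 0 B.radius) :
    ∃ B' : FlowBox Λ X, B'.domain ⊆ B.domain ∧ B.param w₀ z₀ ∈ B'.domain ∧ B'.radius = r ∧
      ∀ w' ∈ B'.transversal, ∃ w ∈ B.transversal, ‖w - w₀‖ < s ∧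
        ∀ z, B'.param w' z = B.param w (z₀ + z) := by
  have hz₀ : z₀ ∈ ball (0 : ℂ) B.radius := hsub (mem_ball_self hr)
  set T : Set ℂ := B.transversal ∩ ball w₀ s with hT
  have hinj : InjOn (fun w => B.height w z₀) B.transversal := fun w hw w' hw' h =>
    (param_injective hw hz₀ hw' hz₀
      (Direction.ext_coord (d := B.dir) (by simp) (by simpa using h))).1
  -- The normalization `f_zero` forces plaques of the new box to be labelled by their height over
  -- the new center; `inv` recovers the old label. Its continuity comes from `ψ` being an embedding.
  set inv : ℂ → ℂ := Function.invFunOn (fun w => B.height w z₀) B.transversal with hinv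
  have hleft : ∀ w ∈ B.transversal, inv (B.height w z₀) = w := fun w hw =>
    hinj.leftInvOn_invFunOn hw
  have hinvT : ∀ w' ∈ (fun w => B.height w z₀) '' T, inv w' ∈ T ∧ B.height (inv w') z₀ = w' := by
    rintro _ ⟨w, hw, rfl⟩
    simp only [hleft w hw.1]
    exact ⟨hw, trivial⟩
  have hshift : ∀ z, z ∈ ball (0 : ℂ) r ↔ z₀ + z ∈ ball z₀ r := fun z => by
    simp
  set Ψ : ball (0 : ℂ) B.radius × B.transversal → ℂ × ℂ := fun q =>
    B.dir.graphPoint B.center (q.2 : ℂ) (q.1 : ℂ) (B.f q.2 q.1) with hΨ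
  obtain ⟨O, hO, hOV⟩ : ∃ O : Set (ℂ × ℂ), IsOpen O ∧
      Ψ ⁻¹' O = {q | (q.1 : ℂ) ∈ ball z₀ r ∧ (q.2 : ℂ) ∈ ball w₀ s} := by
    refine B.isEmbedding.isInducing.isOpen_iff.1 (IsOpen.inter ?_ ?_)
    · exact isOpen_ball.preimage (by fun_prop)
    · exact isOpen_ball.preimage (by fun_prop)
  have hOmem : ∀ w ∈ B.transversal, ∀ z ∈ ball (0 : ℂ) B.radius,
      (B.param w z ∈ O ↔ z ∈ ball z₀ r ∧ w ∈ ball w₀ s) := by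
    intro w hw z hz
    have := Set.ext_iff.1 hOV (⟨z, hz⟩, ⟨w, hw⟩)
    exact this
  have hparam : ∀ w' z, B.dir.graphPoint (B.param w₀ z₀) w' z (B.height (inv w') (z₀ + z) - w') =
      B.param (inv w') (z₀ + z) := fun w' z =>
    Direction.ext_coord (d := B.dir) (by simp [add_assoc]) (by simp)
  let φ : ball (0 : ℂ) r × ((fun w => B.height w z₀) '' T) →
      ball (0 : ℂ) B.radius × B.transversal := fun q =>
    (⟨z₀ + q.1, hsub ((hshift _).1 q.1.2)⟩, ⟨inv q.2, (hinvT _ q.2.2).1.1⟩)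
  have hφc : Continuous φ := by
    have h2 : Continuous fun w' : (fun w => B.height w z₀) '' T =>
        (⟨inv w', (hinvT _ w'.2).1.1⟩ : B.transversal) := by
      have h3 : Continuous fun w' : (fun w => B.height w z₀) '' T =>
          ((⟨z₀, hz₀⟩, ⟨inv w', (hinvT _ w'.2).1.1⟩) :
            ball (0 : ℂ) B.radius × B.transversal) := by
        rw [B.isEmbedding.continuous_iff]
        refine ((B.dir.continuous_graphPoint (B.param w₀ z₀)).comp
          continuous_subtype_val).congr fun w' => ?_
        refine Direction.ext_coord (d := B.dir) (by simp) ?_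
        have := (hinvT _ w'.2).2
        rw [height] at this
        simp [this]
      exact continuous_snd.comp h3
    refine Continuous.prodMk (Continuous.subtype_mk (by fun_prop) _) (h2.comp continuous_snd)
  have hφe : IsEmbedding φ := by
    have hslice : Continuous fun w : B.transversal => B.height w z₀ :=
      B.continuousOn_height.comp_continuous (f := fun w : B.transversal => ((w : ℂ), z₀))
        (by fun_prop) fun w => ⟨w.2, hz₀⟩
    refine IsEmbedding.of_comp
      (g := fun q : ball (0 : ℂ) B.radius × B.transversal =>
        ((q.1 : ℂ) - z₀, B.height q.2 z₀)) hφc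
      (Continuous.prodMk (by fun_prop) (hslice.comp continuous_snd)) ?_
    have : (fun q : ball (0 : ℂ) B.radius × B.transversal =>
        ((q.1 : ℂ) - z₀, B.height q.2 z₀)) ∘ φ = Prod.map Subtype.val Subtype.val := by
      funext q
      simp only [φ, Function.comp_apply, Prod.map, add_sub_cancel_left, (hinvT _ q.2.2).2]
    rw [this]
    exact IsEmbedding.subtypeVal.prodMap IsEmbedding.subtypeVal
  refine ⟨{
    dir := B.dir
    center := B.param w₀ z₀
    domain := B.domain ∩ O
    isOpen_domain := B.isOpen_domain.inter hO
    injOn_proj := B.injOn_proj.mono inter_subset_left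
    radius := r
    radius_pos := hr
    transversal := (fun w => B.height w z₀) '' T
    center_mem := ⟨w₀, ⟨hw₀, mem_ball_self hs⟩, by simp⟩
    f := fun w' z => B.height (inv w') (z₀ + z) - w'
    holomorphic := fun w' hw' => ((differentiableOn_height (hinvT w' hw').1.1).comp
      (by fun_prop) fun z hz => hsub ((hshift z).1 hz)).sub_const _
    f_zero := fun w' hw' => by rw [add_zero, (hinvT w' hw').2, sub_self]
    isEmbedding := by
      convert B.isEmbedding.comp hφe using 1
      funext q
      exact hparam _ _
    range_eq := ?_ }, inter_subset_left, ⟨(param_mem hw₀ hz₀).1, ?_⟩, rfl, ?_⟩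
  · ext y
    constructor
    · rintro ⟨⟨⟨z, hz⟩, ⟨w', hw'⟩⟩, rfl⟩
      obtain ⟨⟨h1, h2⟩, -⟩ := hinvT w' hw'
      have hz' := (hshift z).1 hz
      have h3 := param_mem h1 (hsub hz')
      simp only [hparam]
      exact ⟨⟨h3.1, (hOmem _ h1 _ (hsub hz')).2 ⟨hz', h2⟩⟩, h3.2⟩
    · rintro ⟨⟨hy, hyO⟩, hyX⟩
      obtain ⟨w, hw, z, hz, rfl⟩ := exists_param hy hyX
      obtain ⟨h1, h2⟩ := (hOmem w hw z hz).1 hyO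
      refine ⟨(⟨z - z₀, by rwa [hshift, add_sub_cancel]⟩, ⟨_, w, ⟨hw, h2⟩, rfl⟩), ?_⟩
      have := hparam (B.height w z₀) (z - z₀)
      rw [add_sub_cancel, hleft w hw] at this
      simpa only [add_sub_cancel, hleft w hw] using this
  · exact (hOmem w₀ hw₀ z₀ hz₀).2 ⟨mem_ball_self hr, mem_ball_self hs⟩
  · intro w' hw'
    obtain ⟨⟨h1, h2⟩, -⟩ := hinvT w' hw'
    refine ⟨inv w', h1, by rwa [mem_ball, dist_eq_norm] at h2, fun z => hparam w' z⟩

variable {B B' C : FlowBox Λ X} {z₀ : ℂ}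

/-- A smaller flow box is compatible with the same flow boxes. -/
theorem Compatible.of_recenter (hBC : B.Compatible C) (hdom : B'.domain ⊆ B.domain)
    (hsub : ball z₀ B'.radius ⊆ ball 0 B.radius)
    (hB' : ∀ w' ∈ B'.transversal, ∃ w ∈ B.transversal, ∀ z, B'.param w' z = B.param w (z₀ + z)) :
    B'.Compatible C := by
  have hmem : ∀ z ∈ ball (0 : ℂ) B'.radius, z₀ + z ∈ ball (0 : ℂ) B.radius := fun z hz =>
    hsub (by simpa using hz)
  constructor
  · intro w' hw' c hc
    obtain ⟨w, hw, hp⟩ := hB' w' hw'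
    have h := (hBC.1 w hw c hc).preimage (continuous_const_add z₀)
    convert h.inter (isOpen_ball (x := (0 : ℂ)) (ε := B'.radius)) using 1
    ext z
    simp only [mem_ofPred_eq, mem_inter_iff, mem_preimage, hp]
    exact ⟨fun h => ⟨⟨hmem z h.1, h.2⟩, h.1⟩, fun h => ⟨h.2, h.1.2⟩⟩
  · intro c hc w' hw'
    obtain ⟨w, hw, hp⟩ := hB' w' hw'
    have hcont : ContinuousOn (fun z => proj Λ (C.param c z)) (ball 0 C.radius) :=
      continuous_proj.comp_continuousOn (C.continuousOn_param.comp
        (f := fun z => (c, z)) (by fun_prop) fun z hz => ⟨hc, hz⟩)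
    -- A plaque of `B'` is the part of a plaque of `B` inside the image of `B'.domain`, so the
    -- overlap is cut out of the old one by an open condition.
    have h1 := hcont.isOpen_inter_preimage isOpen_ball (isOpenMap_proj _ B'.isOpen_domain)
    convert (hBC.2 c hc w hw).inter h1 using 1
    ext z
    simp only [mem_ofPred_eq, mem_inter_iff, mem_preimage]
    constructor
    · rintro ⟨hz, y, hy, hyz⟩
      simp only at hyz
      refine ⟨⟨hz, z₀ + y, hmem y hy, ?_⟩, hz, B'.param w' y, (param_mem hw' hy).1, hyz⟩
      simp only
      rw [← hp, hyz]
    · rintro ⟨⟨hz, y, hy, hyz⟩, -, q, hq, hqz⟩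
      simp only at hyz
      refine ⟨hz, ?_⟩
      have hyq : B.param w y = q :=
        B.injOn_proj (param_mem hw hy).1 (hdom hq) (by rw [hyz, hqz])
      obtain ⟨w₁, hw₁, z₁, hz₁, he⟩ := exists_param hq (by rw [← hyq]; exact (param_mem hw hy).2)
      obtain ⟨w₂, hw₂, hp₂⟩ := hB' w₁ hw₁
      have h2 := param_injective hw hy hw₂ (hmem z₁ hz₁) (by rw [hyq, ← he, hp₂])
      refine ⟨z₁, hz₁, ?_⟩
      simp only
      rw [hp, ← h2.2, hyz]

/-- Where the lamination is not nearly invariant, plaques meet their translates in few points. -/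
theorem exists_ncard_inter_translation_le {v : ℂ × ℂ} {w : ℂ} (hw : w ∈ B.transversal)
    (hz₀ : z₀ ∈ ball (0 : ℂ) B.radius) (h : ¬ B.NearlyInvariant v w) :
    ∃ η > 0, ∃ A > 0, ∀ ε : ℂ, ε ≠ 0 → ‖ε‖ < η →
      ∀ a ∈ B.transversal, ‖a - w‖ < η → ∀ b ∈ B.transversal, ‖b - w‖ < η →
      ∀ P ⊆ (fun z => proj Λ (B.param a z)) '' ball z₀ η,
      ∀ Q ⊆ (fun z => proj Λ (B.param b z)) '' ball z₀ η,
      (P ∩ translation Λ (ε • v) '' Q).Finite ∧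
      ((P ∩ translation Λ (ε • v) '' Q).ncard : ℝ) ≤ A * Real.log (1 / ‖ε‖) := by
  obtain ⟨η₁, hη₁, A, hA, hcard⟩ := exists_ncard_gap_le hw hz₀
    (fun h' => h (h'.nearlyInvariant hw hz₀))
  obtain ⟨κ, hκ, hκd⟩ := Metric.isOpen_iff.1 B.isOpen_domain _ (param_mem hw hz₀).1
  obtain ⟨η₂, hη₂, hclose⟩ := exists_param_close hw hz₀
    (ball_mem_nhds (B.param w z₀) (half_pos hκ))
  refine ⟨min η₁ (min η₂ (κ / 2 / (‖v‖ + 1))), by positivity, A, hA, ?_⟩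
  intro ε hε hεη a ha haw b hb hbw P hP Q hQ
  have hball : ball z₀ (min η₁ (min η₂ (κ / 2 / (‖v‖ + 1)))) ⊆ ball z₀ η₁ :=
    ball_subset_ball (min_le_left _ _)
  have hball' : ∀ z ∈ ball z₀ (min η₁ (min η₂ (κ / 2 / (‖v‖ + 1)))), ‖z - z₀‖ < η₂ := by
    intro z hz
    rw [mem_ball, dist_eq_norm] at hz
    exact hz.trans_le ((min_le_right _ _).trans (min_le_left _ _))
  simp only [lt_min_iff] at hεη haw hbw
  obtain ⟨hfin, hle⟩ := hcard ε hε hεη.1 a ha haw.1 b hb hbw.1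
  have hεv : ‖ε • v‖ < κ / 2 := by
    rw [norm_smul]
    have := (lt_div_iff₀ (by positivity)).1 hεη.2.2
    nlinarith [norm_nonneg ε]
  -- For small `ε` the lift of the translated point remains in `B.domain`, where `proj Λ` is
  -- injective. Equality in the torus thus lifts to ℂ² without a lattice vector and becomes a zero
  -- of the gap.
  have hsubset : P ∩ translation Λ (ε • v) '' Q ⊆
      (fun z => proj Λ (B.param a z)) '' {z | z ∈ ball z₀ η₁ ∧ B.gap v ε a b z = 0} := by
    rintro x ⟨hxP, y, hyQ, hyx⟩
    obtain ⟨z, hz, rfl⟩ := hP hxP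
    obtain ⟨z', hz', rfl⟩ := hQ hyQ
    refine ⟨z, ⟨hball hz, ?_⟩, rfl⟩
    obtain ⟨hzR, hza⟩ := hclose a ha haw.2.1 z (hball' z hz)
    obtain ⟨hzR', hzb⟩ := hclose b hb hbw.2.1 z' (hball' z' hz')
    have hmem : B.param b z' + ε • v ∈ B.domain := by
      apply hκd
      rw [mem_ball, dist_eq_norm] at hzb ⊢
      have := norm_add_le (B.param b z' - B.param w z₀) (ε • v)
      rw [sub_add_eq_add_sub] at this
      linarith
    have heq : B.param b z' + ε • v = B.param a z :=
      B.injOn_proj hmem (param_mem ha hzR).1 hyx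
    have ht := congrArg B.dir.tangential heq
    have hn := congrArg B.dir.transverse heq
    simp only [Direction.tangential_add, Direction.transverse_add, Direction.tangential_smul,
      Direction.transverse_smul, tangential_param, transverse_param] at ht hn
    have hz'eq : z - ε * B.dir.tangential v = z' := by linear_combination -ht
    rw [gap, hz'eq, ← hn]
    ring
  refine ⟨(hfin.image _).subset hsubset, le_trans ?_ hle⟩
  exact_mod_cast (Set.ncard_le_ncard hsubset (hfin.image _)).trans (Set.ncard_image_le hfin)

end FlowBox

end TorusLam

/-! ### Local flow boxes and globalization by compactness. -/

namespace TorusLam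

variable {Λ : Submodule ℤ (ℂ × ℂ)} {L : Lamination Λ}

theorem log_one_div_nonneg {ε : ℂ} (hε : ‖ε‖ < 1) : 0 ≤ Real.log (1 / ‖ε‖) := by
  rcases (norm_nonneg ε).eq_or_lt with h | h
  · simp [← h]
  · exact Real.log_nonneg ((one_le_div h).2 hε.le)

namespace FlowBox

/-- Each plaque of the box `B` meets each translate of a plaque of `B` by `(ε, 0)` or `(0, ε)` in
at most `A log (1 / |ε|)` points, if `|ε| < η`. -/
def FewIntersections {X : Set (Torus Λ)} (B : FlowBox Λ X) (η A : ℝ) : Prop :=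
  ∀ ε : ℂ, 0 < ‖ε‖ → ‖ε‖ < η → ∀ e : ℂ × ℂ, e = (ε, 0) ∨ e = (0, ε) →
    ∀ α ∈ B.transversal, ∀ β ∈ B.transversal,
      (B.plaque α ∩ translation Λ e '' B.plaque β).Finite ∧
      ((B.plaque α ∩ translation Λ e '' B.plaque β).ncard : ℝ) ≤ A * Real.log (1 / ‖ε‖)

theorem FewIntersections.mono {X : Set (Torus Λ)} {B : FlowBox Λ X} {η η' A A' : ℝ}
    (h : B.FewIntersections η A) (hη : η' ≤ η) (hη1 : η' ≤ 1) (hA : A ≤ A') :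
    B.FewIntersections η' A' := by
  intro ε hε hεη e he α hα β hβ
  obtain ⟨h1, h2⟩ := h ε hε (hεη.trans_le hη) e he α hα β hβ
  exact ⟨h1, h2.trans
    (mul_le_mul_of_nonneg_right hA (log_one_div_nonneg (hεη.trans_le hη1)))⟩

end FlowBox

namespace Lamination

theorem exists_flowBox_fewIntersections (hL : ¬ L.HasInvariantLineSegments) {x : Torus Λ}
    (hx : x ∈ L.carrier) : ∃ B : FlowBox Λ L.carrier, L.IsFlowBox B ∧ x ∈ B.image ∧
      ∃ η > 0, ∃ A > 0, B.FewIntersections η A := by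
  obtain ⟨B, hB, w, hw, z, hz, rfl⟩ := exists_param_of_mem hx
  have hne : ∀ u v : ℂ × ℂ, det2 u v ≠ 0 → ¬ B.NearlyInvariant v w := fun u v huv hn => by
    have h : proj Λ (B.param w z) ∈ L.nearlyInvariantSet v := ⟨B, hB, w, hw, z, hz, rfl, hn⟩
    rw [nearlyInvariantSet_eq_empty hL huv] at h
    exact h
  -- For each coordinate translation the other basis vector serves as the auxiliary `u` of the
  -- slope.
  obtain ⟨η₁, hη₁, A₁, hA₁, h₁⟩ := FlowBox.exists_ncard_inter_translation_le hw hz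
    (hne (0, 1) (1, 0) (by simp [det2]))
  obtain ⟨η₂, hη₂, A₂, hA₂, h₂⟩ := FlowBox.exists_ncard_inter_translation_le hw hz
    (hne (1, 0) (0, 1) (by simp [det2]))
  obtain ⟨r, hr, hrsub⟩ := Metric.isOpen_iff.1 isOpen_ball z hz
  have hs : 0 < min (min η₁ η₂) r := by positivity
  have hsub : ball z (min (min η₁ η₂) r) ⊆ ball 0 B.radius :=
    (ball_subset_ball (min_le_right _ _)).trans hrsub
  obtain ⟨B', hdom, hmem, hrad, hB'⟩ := B.exists_recenter hw hs (s := min η₁ η₂) (by positivity) hsub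
  refine ⟨B', fun C hC => ?_, ⟨_, hmem, rfl⟩, min (min η₁ η₂) 1, by positivity, max A₁ A₂,
    by positivity, ?_⟩
  · refine (L.compatible B hB C hC).of_recenter hdom (by rw [hrad]; exact hsub) fun w' hw' => ?_
    obtain ⟨a, ha, -, hp⟩ := hB' w' hw'
    exact ⟨a, ha, hp⟩
  intro ε hε hεη e he α hα β hβ
  obtain ⟨a, ha, haw, hpa⟩ := hB' α hα
  obtain ⟨b, hb, hbw, hpb⟩ := hB' β hβ
  simp only [lt_min_iff] at hεη haw hbw
  have hplaque : ∀ γ c, (∀ y, B'.param γ y = B.param c (z + y)) →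
      B'.plaque γ ⊆ (fun y => proj Λ (B.param c y)) '' ball z (min (min η₁ η₂) r) := by
    rintro γ c hp _ ⟨y, hy, rfl⟩
    refine ⟨z + y, ?_, by simp only [hp]⟩
    rw [hrad] at hy
    simpa using hy
  have hball : ∀ {η : ℝ}, min η₁ η₂ ≤ η → ball z (min (min η₁ η₂) r) ⊆ ball z η := fun h =>
    ball_subset_ball ((min_le_left _ _).trans h)
  have hlog := log_one_div_nonneg hεη.2
  have hmono : ∀ {N A : ℝ}, N ≤ A * Real.log (1 / ‖ε‖) → A ≤ max A₁ A₂ →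
      N ≤ max A₁ A₂ * Real.log (1 / ‖ε‖) := fun h hA =>
    h.trans (mul_le_mul_of_nonneg_right hA hlog)
  have hε0 : ε ≠ 0 := norm_pos_iff.1 hε
  rcases he with rfl | rfl
  · have := h₁ ε hε0 hεη.1.1 a ha haw.1 b hb hbw.1
      _ ((hplaque α a hpa).trans (image_mono (hball (min_le_left _ _))))
      _ ((hplaque β b hpb).trans (image_mono (hball (min_le_left _ _))))
    rw [show ε • ((1, 0) : ℂ × ℂ) = (ε, 0) by simp] at this
    exact ⟨this.1, hmono this.2 (le_max_left _ _)⟩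
  · have := h₂ ε hε0 hεη.1.2 a ha haw.2 b hb hbw.2
      _ ((hplaque α a hpa).trans (image_mono (hball (min_le_right _ _))))
      _ ((hplaque β b hpb).trans (image_mono (hball (min_le_right _ _))))
    rw [show ε • ((0, 1) : ℂ × ℂ) = (0, ε) by simp] at this
    exact ⟨this.1, hmono this.2 (le_max_right _ _)⟩

end Lamination

end TorusLam

theorem mainTheorem6 (Λ : Submodule ℤ (ℂ × ℂ)) [DiscreteTopology Λ] [IsZLattice ℝ Λ]
    (L : TorusLam.Lamination Λ) (hL : ¬ L.HasInvariantLineSegments) :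
    ∃ ε₀ : ℝ, 0 < ε₀ ∧ ∃ A : ℝ, 0 < A ∧
      ∃ (n : ℕ) (B : Fin n → TorusLam.FlowBox Λ L.carrier),
        (∀ i, L.IsFlowBox (B i)) ∧
        (∀ x ∈ L.carrier, ∃ i, x ∈ (B i).image) ∧
        ∀ ε : ℂ, 0 < ‖ε‖ → ‖ε‖ < ε₀ →
          ∀ e : ℂ × ℂ, e = (ε, 0) ∨ e = (0, ε) →
            ∀ i, ∀ α ∈ (B i).transversal, ∀ β ∈ (B i).transversal,
              ((B i).plaque α ∩ TorusLam.translation Λ e '' (B i).plaque β).Finite ∧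
              (((B i).plaque α ∩ TorusLam.translation Λ e '' (B i).plaque β).ncard : ℝ)
                ≤ A * Real.log (1 / ‖ε‖) := by
  choose B hBL hBx η hη A hA hB using
    fun x : L.carrier => L.exists_flowBox_fewIntersections hL x.2
  obtain ⟨t, hcover⟩ := L.isCompact_carrier.elim_nhds_subcover' (fun x hx => (B ⟨x, hx⟩).image)
    (fun x hx => (TorusLam.isOpenMap_proj _ (B ⟨x, hx⟩).isOpen_domain).mem_nhds (hBx ⟨x, hx⟩))
  -- The requirement `ε₀ ≤ 1` makes the logarithm nonnegative, so that enlarging `A` weakens the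
  -- bound.
  have hε₀ : ∀ s : Finset L.carrier,
      ∃ ε₀ : ℝ, 0 < ε₀ ∧ ε₀ ≤ 1 ∧ ∃ A₀ : ℝ, 0 < A₀ ∧ ∀ x ∈ s, ε₀ ≤ η x ∧ A x ≤ A₀ := by
    classical
    intro s
    induction s using Finset.induction_on with
    | empty => exact ⟨1, one_pos, le_rfl, 1, one_pos, by simp⟩
    | insert x s hxs ih =>
      obtain ⟨ε₀, h1, h2, A₀, h3, h4⟩ := ih
      refine ⟨min ε₀ (η x), lt_min h1 (hη x), (min_le_left _ _).trans h2, max A₀ (A x),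
        lt_max_of_lt_left h3, fun y hy => ?_⟩
      rcases Finset.mem_insert.1 hy with rfl | hy
      · exact ⟨min_le_right _ _, le_max_right _ _⟩
      · exact ⟨(min_le_left _ _).trans (h4 y hy).1, (h4 y hy).2.trans (le_max_left _ _)⟩
  obtain ⟨ε₀, h1, h2, A₀, h3, h4⟩ := hε₀ t
  refine ⟨ε₀, h1, A₀, h3, t.card, fun i => B (t.equivFin.symm i), fun i => hBL _,
    fun x hx => ?_, ?_⟩
  · obtain ⟨y, hy, hxy⟩ := Set.mem_iUnion₂.1 (hcover hx)
    exact ⟨t.equivFin ⟨y, hy⟩, by simpa using hxy⟩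
  · intro ε hε hεε₀ e he i
    have hi := h4 _ (t.equivFin.symm i).2
    exact (hB _).mono hi.1 h2 hi.2 ε hε hεε₀ e he
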